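/- \textbf{Setting.} Let $\mathcal F$ be a signature of function symbols with fixed arities, $\mathcal V$ a set of variables, and $\mathcal T(\mathcal F,\mathcal V)$ the set of terms. A term rewrite system (TRS) $\mathcal R$ is a (possibly infinite) set of rules $\ell\to r$ with $\ell,r\in\mathcal T(\mathcal F,\mathcal V)$, $\ell\notin\mathcal V$ and $\mathrm{Var}(r)\subseteq\mathrm{Var}(\ell)$; $\to_{\mathcal R}$ is its rewrite relation. $\mathcal R$ is \emph{left-linear} if no variable occurs twice in a left-hand side. $\mathcal R$ is \emph{bounded duplicating} if, for a fresh unary symbol $\Diamond$, the relation $\to_{\mathcal R}^*\cdot\to_{\{\Diamond(x)\to x\}}\cdot\to_{\mathcal R}^*$ on $\mathcal T(\mathcal F\cup\{\Diamond\},\mathcal V)$ is terminating. A relation $\to$ is \emph{confluent} if $b\mathrel{{}^*{\leftarrow}}a\to^*c$ implies $b\to^*d\mathrel{{}^*{\leftarrow}}c$ for some $d$; it is \emph{confluent on} a set $T$ if $T$ is closed under $\to$ and ${\to}\cap(T\times T)$ is confluent. \textbf{Sorts.} Let $S$ be a set of sorts with a partial order $\succeq$. A \emph{sort attachment} $\mathcal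 S$ assigns to each $n$-ary $f\in\mathcal F$ a type $f:\alpha_1\times\cdots\times\alpha_n\to\alpha$ with $\alpha_i,\alpha\in S$, and to each variable a sort in $S$, such that for each $\alpha\in S$ the set $\mathcal V_\alpha$ of variables of sort $\alpha$ is countably infinite. The \emph{terms of sort} $\alpha$ are, inductively, the elements of $\mathcal V_\alpha$ and the terms $f(t_1,\dots,t_n)$ where $f:\alpha_1\times\cdots\times\alpha_n\to\alpha$ and each $t_i$ is a term of some sort $\beta_i$ with $\alpha_i\succeq\beta_i$. A term is \emph{order-sorted} if it has a sort (which is then unique); $\mathcal T_{\mathcal S}(\mathcal F,\mathcal V)$ is the set of order-sorted terms. An order-sorted term is \emph{strictly order-sorted} if, whenever a variable of sort $\beta$ occurs in it as the $i$-th argument of a symbol $f:\alpha_1\times\cdots\times\alpha_n\to\alpha$, then $\beta=\alpha_i$. $\mathcal R$ is \emph{compatible} with $\mathcal S$ if for each rule $\ell\to r$ in $\mathcal R$ both $\ell$ and $r$ are order-sorted, of sorts $\alpha$ and $\beta$ with $\alpha\succeq\beta$, and $\ell$ is strictly order-sorted. It is \emph{strongly compatible} with $\mathcal S$ if moreover,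 for each rule $\ell\to r$, if $r$ is a variable then its sort is maximal in $S$, and if $r$ is not a variable then $r$ is strictly order-sorted. \textbf{Theorem (order-sorted persistence of confluence).} Let $\mathcal R$ be a TRS that is compatible with a sort attachment $\mathcal S$. Assume that $\mathcal R$ is left-linear, or bounded duplicating, or strongly compatible with $\mathcal S$. If $\mathcal R$ is confluent on $\mathcal T_{\mathcal S}(\mathcal F,\mathcal V)$, then $\mathcal R$ is confluent (on all terms of $\mathcal T(\mathcal F,\mathcal V)$). -/

import Mathlib

/-! First-order term rewriting. A signature is a first-order language, of which only the function
symbols matter; terms over variables `V` are Mathlib's `L.Term V`. -/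

namespace OrderSorted

open FirstOrder.Language (Term LHom)

universe u v w z

section Abstract

variable {X : Type u}

/-- Two reducts of a common element always have a common reduct. -/
def Confluent (r : X → X → Prop) : Prop :=
  ∀ a b c, Relation.ReflTransGen r a b → Relation.ReflTransGen r a c →
    ∃ d, Relation.ReflTransGen r b d ∧ Relation.ReflTransGen r c d

/-- `T` is closed under `r`, and the restriction of `r` to `T` is confluent. -/
def ConfluentOn (r : X → X → Prop) (T : Set X) : Prop :=
  (∀ a b, a ∈ T → r a b → b ∈ T) ∧ Confluent (fun a b => a ∈ T ∧ b ∈ T ∧ r a b)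

/-- There is no infinite sequence `a₀ r a₁ r a₂ r ⋯`. -/
def Terminating (r : X → X → Prop) : Prop :=
  WellFounded (fun a b => Relation.TransGen r b a)

/-- The relative relation `r / s`, that is `s* · r · s*`. -/
def Relative (r s : X → X → Prop) (a d : X) : Prop :=
  ∃ b c, Relation.ReflTransGen s a b ∧ r b c ∧ Relation.ReflTransGen s c d

end Abstract

section Rewriting

variable {L : FirstOrder.Language.{u, v}} {V : Type w}

open Classical in
/-- The number of occurrences of the variable `x` in a term. -/
noncomputable def occ (x : V) : L.Term V → ℕ
  | Term.var y => if y = x then 1 else 0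
  | Term.func _ ts => ∑ i, occ x (ts i)

/-- Each variable occurs at most once. -/
def Linear (t : L.Term V) : Prop := ∀ x, occ x t ≤ 1

/-- The rewrite relation induced by a set of pairs of terms. -/
inductive Step (R : Set (L.Term V × L.Term V)) : L.Term V → L.Term V → Prop
  | root {l r : L.Term V} (h : (l, r) ∈ R) (σ : V → L.Term V) : Step R (l.subst σ) (r.subst σ)
  | arg {n : ℕ} (f : L.Functions n) (ts : Fin n → L.Term V) (i : Fin n) {t : L.Term V}
      (h : Step R (ts i) t) : Step R (Term.func f ts) (Term.func f (Function.update ts i t))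

variable (L V) in
/-- A term rewrite system: a set of rules `l → r` where `l` is not a variable and every variable
of `r` occurs in `l`. -/
structure TRS where
  rules : Set (L.Term V × L.Term V)
  lhs_not_var : ∀ l r, (l, r) ∈ rules → ∀ x, l ≠ Term.var x
  vars_subset : ∀ l r, (l, r) ∈ rules → ∀ x, 0 < occ x r → 0 < occ x l

/-- All left-hand sides are linear. -/
def TRS.LeftLinear (R : TRS L V) : Prop := ∀ l r, (l, r) ∈ R.rules → Linear l

/-- The function symbols of the signature with a single symbol `◇`, which is unary. -/
inductive DiamondFun : ℕ → Type u
  | diamond : DiamondFun 1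

/-- The signature consisting of the unary function symbol `◇`. -/
def diamondLang : FirstOrder.Language.{u, v} := ⟨DiamondFun, fun _ => PEmpty⟩

variable (L) in
/-- The signature `L` extended by a fresh unary function symbol `◇`. -/
abbrev withDiamond : FirstOrder.Language.{u, v} := L.sum diamondLang.{u, v}

/-- The term `◇(t)`. -/
def diamondTerm (t : (withDiamond L).Term V) : (withDiamond L).Term V :=
  Term.func (L := withDiamond L) (l := 1) (Sum.inr DiamondFun.diamond) (fun _ => t)

/-- The rule `◇(x) → x`. -/
def diamondRules : Set ((withDiamond L).Term V × (withDiamond L).Term V) :=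
  {p | ∃ x : V, p = (diamondTerm (Term.var x), Term.var x)}

/-- The rules of `R`, over the signature extended by `◇`. -/
def TRS.liftRules (R : TRS L V) : Set ((withDiamond L).Term V × (withDiamond L).Term V) :=
  {p | ∃ l r, (l, r) ∈ R.rules ∧ p = (LHom.sumInl.onTerm l, LHom.sumInl.onTerm r)}

/-- `R` is bounded duplicating: `{◇(x) → x} / R` is terminating, for a fresh unary `◇`. -/
def TRS.BoundedDuplicating (R : TRS L V) : Prop :=
  Terminating (Relative (Step (diamondRules (L := L) (V := V))) (Step R.liftRules))

end Rewriting

section Sorted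

variable {L : FirstOrder.Language.{u, v}} {V : Type w} {S : Type z}

variable (L V S) in
/-- A sort attachment: each function symbol of arity `n` gets `n` argument sorts and a result
sort, each variable gets a sort, and there are countably infinitely many variables of each sort. -/
structure SortAttachment where
  argSort : ∀ {n : ℕ}, L.Functions n → Fin n → S
  resSort : ∀ {n : ℕ}, L.Functions n → S
  varSort : V → S
  infinite_vars : ∀ α : S, {x : V | varSort x = α}.Infinite
  countable_vars : ∀ α : S, {x : V | varSort x = α}.Countable

/-- Whenever a variable occurs in `t` as an argument of a function symbol, its sort equals the
corresponding argument sort. -/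
def StrictVars (A : SortAttachment L V S) : L.Term V → Prop
  | Term.var _ => True
  | Term.func f ts =>
      ∀ i, (∀ x, ts i = Term.var x → A.argSort f i = A.varSort x) ∧ StrictVars A (ts i)

variable [PartialOrder S]

/-- `HasSort A t α`: `t` is an order-sorted term of sort `α`. A term is allowed as an argument if
its sort is less than or equal to the argument sort. -/
inductive HasSort (A : SortAttachment L V S) : L.Term V → S → Prop
  | var (x : V) : HasSort A (Term.var x) (A.varSort x)
  | func {n : ℕ} (f : L.Functions n) (ts : Fin n → L.Term V) (β : Fin n → S)
      (h : ∀ i, HasSort A (ts i) (β i)) (hle : ∀ i, β i ≤ A.argSort f i) :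
      HasSort A (Term.func f ts) (A.resSort f)

/-- The set of order-sorted terms. -/
def sortedTerms (A : SortAttachment L V S) : Set (L.Term V) := {t | ∃ α, HasSort A t α}

/-- An order-sorted term is strictly order-sorted if its variables occur, as arguments, only where
their sort is exactly the required one. -/
def StrictlySorted (A : SortAttachment L V S) (t : L.Term V) : Prop :=
  t ∈ sortedTerms A ∧ StrictVars A t

/-- In each rule both sides are order-sorted, the sort of the left-hand side is greater than or
equal to that of the right-hand side, and the left-hand side is strictly order-sorted. -/
def TRS.Compatible (R : TRS L V) (A : SortAttachment L V S) : Prop :=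
  ∀ l r, (l, r) ∈ R.rules →
    (∃ α β, HasSort A l α ∧ HasSort A r β ∧ β ≤ α) ∧ StrictlySorted A l

/-- Compatible, and moreover a right-hand side that is a variable has a maximal sort, and all other
right-hand sides are strictly order-sorted. -/
def TRS.StronglyCompatible (R : TRS L V) (A : SortAttachment L V S) : Prop :=
  R.Compatible A ∧ ∀ l r, (l, r) ∈ R.rules →
    (∀ x, r = Term.var x → IsMax (A.varSort x)) ∧
    ((∀ x, r ≠ Term.var x) → StrictlySorted A r)

end Sorted

end OrderSorted

/-! The proof has two halves. The first passes from order-sorted terms to terms whose function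
symbols respect the sorts while variables may stand anywhere (`confAt_of_fit`). Renaming a variable
`w` at a position of sort `α` to `(w, α)` makes such a term order-sorted, but copies of `w` with
different labels are no longer equal, so a non-linear rule may cease to apply. For left-linear
systems every step lifts to labelled terms anyway; under strong compatibility labelling commutes
with steps; for bounded duplicating systems labels are renormalized during rewriting, and each
renormalization that changes something consumes diamonds.

The second half treats arbitrary terms. A term is cut at its maximal subterms that violate the
sorts, its aliens. By induction on the nesting of cuts, rewriting of aliens is confluent, so aliens
can be abstracted to variables that name their convertibility classes. The remaining top is
confluent by the first half, and a common reduct of two tops is instantiated with representatives to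
which the finitely many aliens in question reduce (`exists_balanced`).

The obstacle is fusion: an alien may rewrite to a term that fits its position and so merges with the
layer above. For left-linear or bounded duplicating systems the cuts are frozen by marks, which
gives confluence of marked terms (`mconfAt_of_mfit`). The marks are then discarded: their removal
commutes with left-linear rewriting, and in the bounded duplicating case marks are diamonds, so that
`confAt_of_normalize` applies. Under strong compatibility no marks are used. Every term reduces to
one whose aliens never fuse (`exists_preserved`), and replacing aliens by tops of such
representatives turns each step into joinability of sort-respecting terms (`joinable_barTerm`). -/

namespace OrderSorted

open FirstOrder.Language (Term LHom)
open Relation (ReflTransGen TransGen)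

/-! ### Abstract confluence, representatives of convertibility classes, and transfer along an
erasure. -/

section AbstractRewriting

variable {X Y : Type*}

/-- Any two reducts of `a` have a common reduct. -/
def ConfAt (r : X → X → Prop) (a : X) : Prop :=
  ∀ b c, ReflTransGen r a b → ReflTransGen r a c →
    ∃ d, ReflTransGen r b d ∧ ReflTransGen r c d

/-- `a` and `b` have a common reduct. -/
def Joinable (r : X → X → Prop) (a b : X) : Prop :=
  ∃ d, ReflTransGen r a d ∧ ReflTransGen r b d

theorem Joinable.symm {r : X → X → Prop} {a b : X} (h : Joinable r a b) : Joinable r b a := by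
  obtain ⟨d, h1, h2⟩ := h
  exact ⟨d, h2, h1⟩

theorem Joinable.refl {r : X → X → Prop} (a : X) : Joinable r a a := ⟨a, .refl, .refl⟩

theorem Joinable.of_rtg {r : X → X → Prop} {a b : X} (h : ReflTransGen r a b) :
    Joinable r a b := ⟨b, h, .refl⟩

theorem Joinable.trans {r : X → X → Prop} {a b c : X} (hb : ConfAt r b)
    (h₁ : Joinable r a b) (h₂ : Joinable r b c) : Joinable r a c := by
  obtain ⟨d, h1, h2⟩ := h₁
  obtain ⟨e, h3, h4⟩ := h₂
  obtain ⟨f, h5, h6⟩ := hb d e h2 h3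
  exact ⟨f, h1.trans h5, h4.trans h6⟩

theorem rtg_invariant {r : X → X → Prop} {I : X → Prop} (hI : ∀ a b, I a → r a b → I b) {a b : X}
    (ha : I a) (h : ReflTransGen r a b) : I b := by
  induction h with
  | refl => exact ha
  | tail _ h ih => exact hI _ _ ih h

theorem rtg_restrict {r : X → X → Prop} {I : X → Prop} (hI : ∀ a b, I a → r a b → I b) {a b : X}
    (ha : I a) (h : ReflTransGen r a b) : ReflTransGen (fun x y => I x ∧ r x y) a b := by
  induction h with
  | refl => exact .refl
  | tail h₁ h ih => exact ih.tail ⟨rtg_invariant hI ha h₁, h⟩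

theorem rtg_of_restrict {r : X → X → Prop} {I : X → Prop} {a b : X}
    (h : ReflTransGen (fun x y => I x ∧ r x y) a b) : ReflTransGen r a b :=
  h.lift id fun _ _ h => h.2

theorem confluent_restrict {r : X → X → Prop} {I : X → Prop} (hI : ∀ a b, I a → r a b → I b)
    (h : ∀ a, I a → ConfAt r a) : Confluent (fun x y => I x ∧ r x y) := by
  intro a b c hb hc
  by_cases ha : I a
  · obtain ⟨d, h1, h2⟩ := h a ha b c (rtg_of_restrict hb) (rtg_of_restrict hc)
    exact ⟨d, rtg_restrict hI (rtg_invariant hI ha (rtg_of_restrict hb)) h1,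
      rtg_restrict hI (rtg_invariant hI ha (rtg_of_restrict hc)) h2⟩
  · have key : ∀ z, ReflTransGen (fun x y => I x ∧ r x y) a z → z = a := by
      intro z hz
      rcases hz.cases_head with h | ⟨w, hw, _⟩
      · exact h.symm
      · exact absurd hw.1 ha
    rw [key b hb, key c hc]
    exact ⟨a, .refl, .refl⟩

/-- Church–Rosser: equality in `Quot r` is convertibility, as `Quot` divides by the generated
equivalence relation. -/
theorem joinable_of_quot_eq {r : X → X → Prop} (hr : Confluent r) {a b : X}
    (h : Quot.mk r a = Quot.mk r b) : Joinable r a b := by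
  have := Quot.eqvGen_exact h
  clear h
  induction this with
  | rel x y h => exact .of_rtg (.single h)
  | refl x => exact .refl x
  | symm x y _ ih => exact ih.symm
  | trans x y z _ _ ih₁ ih₂ => exact .trans (hr y) ih₁ ih₂

theorem quot_eq_of_rtg {r : X → X → Prop} {a b : X} (h : ReflTransGen r a b) :
    Quot.mk r a = Quot.mk r b := by
  induction h with
  | refl => rfl
  | tail _ h ih => exact ih.trans (Quot.sound h)

/-- Representatives of the convertibility classes can be chosen such that every element of a given
finite set reduces to the representative of its class. -/
theorem exists_balanced {r : X → X → Prop} (hr : Confluent r) {F : Set X} (hF : F.Finite) :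
    ∃ φ : Quot r → X, (∀ c, Quot.mk r (φ c) = c) ∧
      ∀ u ∈ F, ReflTransGen r u (φ (Quot.mk r u)) := by
  classical
  induction F, hF using Set.Finite.induction_on with
  | empty => exact ⟨Quot.out, Quot.out_eq, by simp⟩
  | @insert u F _ _ ih =>
    obtain ⟨φ, h1, h2⟩ := ih
    obtain ⟨d, h3, h4⟩ := joinable_of_quot_eq hr (h1 (Quot.mk r u))
    -- Moving the representative to `d`, a common reduct of the old one and `u`, keeps it reachable
    -- from the elements treated before.
    refine ⟨Function.update φ (Quot.mk r u) d, fun c => ?_, fun v hv => ?_⟩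
    · by_cases hc : c = Quot.mk r u
      · subst hc
        simpa using (quot_eq_of_rtg h4).symm
      · simpa [hc] using h1 c
    · rcases hv with rfl | hv
      · simpa using h4
      · by_cases hc : Quot.mk r v = Quot.mk r u
        · have := h2 v hv
          rw [hc] at this ⊢
          simpa using this.trans h3
        · simpa [hc] using h2 v hv

/-- Transfer of confluence along an erasure `e : X → Y` for which steps can be lifted from normal
forms only, when normalization decreases a well-founded relation. -/
theorem confAt_of_normalize (rX : X → X → Prop) (rY : Y → Y → Prop) (e : X → Y) (nf : X → X)
    (I : X → Prop) (hI : ∀ x y, I x → rX x y → I y) (hInf : ∀ x, I x → I (nf x))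
    (proj : ∀ x y, rX x y → rY (e x) (e y)) (e_nf : ∀ x, I x → e (nf x) = e x)
    (lift : ∀ x b, I x → rY (e x) b → ∃ y, rX (nf x) y ∧ e y = b)
    (conf : ∀ x, I x → ConfAt rX x) (gt : X → X → Prop) (wf : WellFounded fun a b => gt b a)
    (dec : ∀ x y, I x → ReflTransGen rX x y → nf y ≠ y → gt x (nf y)) (x : X) (hx : I x) :
    ConfAt rY (e x) := by
  induction x using wf.induction with
  | _ x ih =>
  by_cases hn : nf x = x
  swap
  · rw [← e_nf x hx]
    exact ih _ (dec x x hx .refl hn) (hInf x hx)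
  have proj' : ∀ {x y}, ReflTransGen rX x y → ReflTransGen rY (e x) (e y) := fun h =>
    h.lift e fun _ _ => proj _ _
  have inv : ∀ {y}, ReflTransGen rX x y → I y := fun h => rtg_invariant hI hx h
  -- A reduction of `e x` is lifted as long as the lifted terms are normal; at the first `y` that is
  -- not, lifting stops and the rest of the reduction stays below.
  have key : ∀ b, ReflTransGen rY (e x) b → ∃ y, ReflTransGen rX x y ∧ ReflTransGen rY (e y) b ∧
      (e y = b ∨ nf y ≠ y) := by
    intro b hb
    induction hb with
    | refl => exact ⟨x, .refl, .refl, .inl rfl⟩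
    | tail _ h ih' =>
      obtain ⟨y, h1, h2, h3⟩ := ih'
      by_cases hy : nf y = y
      · obtain rfl := h3.resolve_right (by simpa using hy)
        obtain ⟨z, h4, h5⟩ := lift y _ (inv h1) h
        rw [hy] at h4
        exact ⟨z, h1.tail h4, h5 ▸ .refl, .inl h5⟩
      · exact ⟨y, h1, h2.tail h, .inr hy⟩
  -- Where lifting stopped, the induction hypothesis applies to `nf y`, which has the same erasure
  -- as `y`.
  have conf' : ∀ {y}, ReflTransGen rX x y → nf y ≠ y → ConfAt rY (e y) := fun {y} h hy => by
    rw [← e_nf y (inv h)]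
    exact ih _ (dec x y hx h hy) (hInf y (inv h))
  have side : ∀ {y b z}, ReflTransGen rX x y → ReflTransGen rY (e y) b → (e y = b ∨ nf y ≠ y) →
      ReflTransGen rX y z → Joinable rY b (e z) := by
    intro y b z hy hb hor hz
    rcases hor with rfl | hn
    · exact .of_rtg (proj' hz)
    · exact conf' hy hn _ _ hb (proj' hz)
  intro b c hb hc
  obtain ⟨y, hy, hyb, hy'⟩ := key b hb
  obtain ⟨z, hz, hzc, hz'⟩ := key c hc
  obtain ⟨d, hd₁, hd₂⟩ := conf x hx y z hy hz
  have j₁ := side hy hyb hy' hd₁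
  have j₂ := side hz hzc hz' hd₂
  rcases hy' with rfl | hny
  · obtain ⟨m, hm₁, hm₂⟩ := j₂
    exact ⟨m, (proj' hd₁).trans hm₂, hm₁⟩
  · exact j₁.trans (fun p q hp hq => conf' hy hny p q ((proj' hd₁).trans hp)
      ((proj' hd₁).trans hq)) j₂.symm

theorem rtg_pointwise {n : ℕ} {r : X → X → Prop} {s : Y → Y → Prop} (g : (Fin n → X) → Y)
    (hg : ∀ ts i t, r (ts i) t → s (g ts) (g (Function.update ts i t))) {ts us : Fin n → X}
    (h : ∀ i, ReflTransGen r (ts i) (us i)) : ReflTransGen s (g ts) (g us) := by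
  classical
  have one : ∀ ts i t, ReflTransGen r (ts i) t →
      ReflTransGen s (g ts) (g (Function.update ts i t)) := by
    intro ts i t h
    induction h with
    | refl => rw [Function.update_eq_self]
    | tail _ h ih =>
      refine ih.tail ?_
      have := hg (Function.update ts i _) i _ (by rw [Function.update_self]; exact h)
      rwa [Function.update_idem] at this
  have key : ∀ F : Finset (Fin n),
      ReflTransGen s (g ts) (g fun i => if i ∈ F then us i else ts i) := by
    intro F
    induction F using Finset.induction_on with
    | empty => simp [ReflTransGen.refl]
    | @insert i F hi ih =>
      have := one (fun j => if j ∈ F then us j else ts j) i (us i) (by simpa [hi] using h i)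
      refine (ih.trans this).trans (Eq.subst ?_ ReflTransGen.refl)
      congr 1
      funext j
      by_cases hj : j = i
      · subst hj; simp
      · simp [hj]
  simpa using key Finset.univ

end AbstractRewriting

/-! ### Evaluation of terms and matching of linear patterns. -/

section Terms

variable {L : FirstOrder.Language} {V W M N : Type*}

/-- The value of a term under an interpretation of the function symbols and the variables. -/
def eval (F : ∀ {n}, L.Functions n → (Fin n → M) → M) (σ : V → M) : L.Term V → M
  | .var x => σ x
  | .func f ts => F f fun i => eval F σ (ts i)

/-- The variable `x` occurs in a term. -/
def Mem (x : V) : L.Term V → Prop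
  | .var y => y = x
  | .func _ ts => ∃ i, Mem x (ts i)

theorem occ_pos_iff (x : V) (t : L.Term V) : 0 < occ x t ↔ Mem x t := by
  induction t with
  | var y => by_cases h : y = x <;> simp [occ, Mem, h]
  | func f ts ih => simp [occ, Mem, Finset.sum_pos_iff, ih]

theorem finite_mem (t : L.Term V) : {x | Mem x t}.Finite := by
  induction t with
  | var y => simp [Mem]
  | func f ts ih =>
    have : {x | Mem x (.func f ts)} = ⋃ i, {x | Mem x (ts i)} := by
      ext x; simp [Mem]
    rw [this]
    exact Set.finite_iUnion ih

theorem subst_eq_eval (σ : V → L.Term W) (t : L.Term V) :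
    t.subst σ = eval (fun f ts => .func f ts) σ t := by
  induction t with
  | var x => rfl
  | func f ts ih => simp [Term.subst, eval, ih]

theorem eval_congr {F : ∀ {n}, L.Functions n → (Fin n → M) → M} {σ τ : V → M} {t : L.Term V}
    (h : ∀ x, Mem x t → σ x = τ x) : eval F σ t = eval F τ t := by
  induction t with
  | var x => exact h x rfl
  | func f ts ih =>
    simp only [eval]
    congr 1
    funext i
    exact ih i fun x hx => h x ⟨i, hx⟩

theorem map_eval {F : ∀ {n}, L.Functions n → (Fin n → M) → M}
    {G : ∀ {n}, L.Functions n → (Fin n → N) → N} (g : M → N)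
    (hg : ∀ {n} (f : L.Functions n) ts, g (F f ts) = G f fun i => g (ts i)) (σ : V → M)
    (t : L.Term V) : g (eval F σ t) = eval G (fun x => g (σ x)) t := by
  induction t with
  | var x => rfl
  | func f ts ih => simp [eval, hg, ih]

theorem eval_subst {F : ∀ {n}, L.Functions n → (Fin n → M) → M} (τ : W → M) (σ : V → L.Term W)
    (t : L.Term V) : eval F τ (t.subst σ) = eval F (fun x => eval F τ (σ x)) t := by
  rw [subst_eq_eval]
  exact map_eval (eval F τ) (fun _ _ => rfl) σ t

theorem eval_forall_iff {σ : V → Prop} {t : L.Term V} :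
    eval (fun _ ps => ∀ i, ps i) σ t ↔ ∀ x, Mem x t → σ x := by
  induction t with
  | var x => simp [eval, Mem]
  | func f ts ih => simp only [eval, Mem, ih]; exact ⟨fun h x ⟨i, hi⟩ => h i x hi,
      fun h i x hx => h x ⟨i, hx⟩⟩

theorem eval_sup_le_iff {σ : V → ℕ} {t : L.Term V} {k : ℕ} :
    eval (fun _ ms => Finset.univ.sup ms) σ t ≤ k ↔ ∀ x, Mem x t → σ x ≤ k := by
  induction t with
  | var x => simp [eval, Mem]
  | func f ts ih => simp only [eval, Mem, Finset.sup_le_iff, ih]; exact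
      ⟨fun h x ⟨i, hi⟩ => h i (Finset.mem_univ i) x hi, fun h i _ x hx => h x ⟨i, hx⟩⟩

theorem mem_subst {σ : V → L.Term W} {t : L.Term V} {w : W} :
    Mem w (t.subst σ) ↔ ∃ x, Mem x t ∧ Mem w (σ x) := by
  induction t with
  | var x => simp [Term.subst, Mem]
  | func f ts ih =>
    simp only [Term.subst, Mem, ih]
    exact ⟨fun ⟨i, x, h, h'⟩ => ⟨x, ⟨i, h⟩, h'⟩, fun ⟨x, ⟨i, h⟩, h'⟩ => ⟨i, x, h, h'⟩⟩

/-- A linear pattern can be matched along any relation that respects function symbols. -/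
theorem Linear.match {F : ∀ {n}, L.Functions n → (Fin n → M) → M}
    {G : ∀ {n}, L.Functions n → (Fin n → N) → N} {E : M → N → Prop}
    (hE : ∀ {n} (f : L.Functions n) ts u, E (F f ts) u → ∃ us, u = G f us ∧ ∀ i, E (ts i) (us i))
    {l : L.Term V} (hl : Linear l) {σ : V → M} {u : N} (hu : E (eval F σ l) u) :
    ∃ τ : V → N, u = eval G τ l ∧ ∀ x, Mem x l → E (σ x) (τ x) := by
  classical
  induction l generalizing u with
  | var x => exact ⟨fun _ => u, rfl, fun y hy => by obtain rfl : x = y := hy; exact hu⟩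
  | func f ts ih =>
    obtain ⟨us, rfl, hus⟩ := hE f _ u hu
    have hlin : ∀ i, Linear (ts i) := fun i x =>
      (Finset.single_le_sum (f := fun i => occ x (ts i)) (fun _ _ => Nat.zero_le _)
        (Finset.mem_univ i)).trans (hl x)
    choose τ h1 h2 using fun i => ih i (hlin i) (hus i)
    have huniq : ∀ x i j, Mem x (ts i) → Mem x (ts j) → i = j := by
      intro x i j hi hj
      by_contra hij
      have h : ∑ k ∈ {i, j}, occ x (ts k) ≤ ∑ k, occ x (ts k) :=
        Finset.sum_le_sum_of_subset (Finset.subset_univ _)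
      rw [Finset.sum_pair hij] at h
      have h' : ∑ k, occ x (ts k) ≤ 1 := hl x
      have := (occ_pos_iff x _).2 hi
      have := (occ_pos_iff x _).2 hj
      omega
    -- By linearity the argument containing `x` is unique, so the matchers glue; `G f us` is an
    -- arbitrary value for variables that do not occur.
    let τ' : V → N := fun x => if h : ∃ i, Mem x (ts i) then τ h.choose x else G f us
    have hτ : ∀ x i, Mem x (ts i) → τ' x = τ i x := by
      intro x i hi
      have h : ∃ i, Mem x (ts i) := ⟨i, hi⟩
      simp only [τ', dif_pos h, huniq x _ i h.choose_spec hi]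
    refine ⟨τ', ?_, fun x ⟨i, hi⟩ => hτ x i hi ▸ h2 i x hi⟩
    simp only [eval]
    congr 1
    funext i
    rw [h1 i]
    exact eval_congr fun x hx => (hτ x i hx).symm

end Terms
end OrderSorted

namespace OrderSorted

open FirstOrder.Language (Term LHom)
open Relation (ReflTransGen TransGen)

theorem update_map {ι X Y : Type*} [DecidableEq ι] (g : ι → X → Y) (ts : ι → X) (i : ι) (t : X) :
    (fun j => g j (Function.update ts i t j)) = Function.update (fun j => g j (ts j)) i (g i t) :=
  funext fun j => Function.apply_update g ts i t j

/-! ### Rewriting over an arbitrary set of variables. -/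

section Rewriting

variable {L : FirstOrder.Language} {V W Y : Type*}

/-- The rewrite relation of `R` on terms over an arbitrary set of variables. -/
inductive St (R : TRS L V) : L.Term W → L.Term W → Prop
  | root {l r : L.Term V} (h : (l, r) ∈ R.rules) (σ : V → L.Term W) :
      St R (l.subst σ) (r.subst σ)
  | arg {n : ℕ} (f : L.Functions n) (ts : Fin n → L.Term W) (i : Fin n) {t : L.Term W}
      (h : St R (ts i) t) : St R (.func f ts) (.func f (Function.update ts i t))

variable {R : TRS L V}

theorem st_iff_step {s t : L.Term V} : St R s t ↔ Step R.rules s t := by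
  constructor <;> intro h
  · induction h with
    | root h σ => exact .root h σ
    | arg f ts i _ ih => exact .arg f ts i ih
  · induction h with
    | root h σ => exact .root h σ
    | arg f ts i _ ih => exact .arg f ts i ih

theorem TRS.mem_of_mem (R : TRS L V) {l r : L.Term V} (h : (l, r) ∈ R.rules) {x : V}
    (hx : Mem x r) : Mem x l :=
  (occ_pos_iff x l).1 (R.vars_subset l r h x ((occ_pos_iff x r).2 hx))

theorem subst_comp (τ : W → L.Term Y) (σ : V → L.Term W) (t : L.Term V) :
    (t.subst σ).subst τ = t.subst fun x => (σ x).subst τ := by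
  simp only [subst_eq_eval]
  exact map_eval (eval (fun f ts => Term.func f ts) τ) (fun _ _ => rfl) σ t

theorem subst_congr {σ τ : V → L.Term W} {t : L.Term V} (h : ∀ x, Mem x t → σ x = τ x) :
    t.subst σ = t.subst τ := by
  simp only [subst_eq_eval]
  exact eval_congr h

theorem subst_var (t : L.Term V) : t.subst Term.var = t := by
  induction t with
  | var x => rfl
  | func f ts ih => simp [Term.subst, ih]

theorem St.subst {s t : L.Term W} (h : St R s t) (τ : W → L.Term Y) :
    St R (s.subst τ) (t.subst τ) := by
  induction h with
  | root h σ => simpa only [subst_comp] using St.root h _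
  | arg f ts i h ih =>
    simp only [Term.subst]
    rw [update_map (fun _ (u : L.Term W) => u.subst τ)]
    exact .arg f _ i ih

theorem rtg_subst {s t : L.Term W} (h : ReflTransGen (St R) s t) (τ : W → L.Term Y) :
    ReflTransGen (St R) (s.subst τ) (t.subst τ) :=
  h.lift _ fun _ _ h => h.subst τ

theorem rtg_func {n : ℕ} (f : L.Functions n) {ts us : Fin n → L.Term W}
    (h : ∀ i, ReflTransGen (St R) (ts i) (us i)) :
    ReflTransGen (St R) (.func f ts) (.func f us) :=
  rtg_pointwise (Term.func f) (fun ts i _ h => .arg f ts i h) h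

theorem joinable_func {n : ℕ} (f : L.Functions n) {ts us : Fin n → L.Term W}
    (h : ∀ i, Joinable (St R) (ts i) (us i)) : Joinable (St R) (.func f ts) (.func f us) := by
  choose vs h1 h2 using h
  exact ⟨_, rtg_func f h1, rtg_func f h2⟩

theorem rtg_subst_of_forall {t : L.Term W} {σ τ : W → L.Term Y}
    (h : ∀ x, Mem x t → ReflTransGen (St R) (σ x) (τ x)) :
    ReflTransGen (St R) (t.subst σ) (t.subst τ) := by
  induction t with
  | var x => exact h x rfl
  | func f ts ih => exact rtg_func f fun i => ih i fun x hx => h x ⟨i, hx⟩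

theorem St.mem {s t : L.Term W} (h : St R s t) {w : W} (hw : Mem w t) : Mem w s := by
  induction h with
  | root h σ =>
    obtain ⟨x, hx, hx'⟩ := mem_subst.1 hw
    exact mem_subst.2 ⟨x, R.mem_of_mem h hx, hx'⟩
  | arg f ts i h ih =>
    obtain ⟨j, hj⟩ := hw
    by_cases hji : j = i
    · subst hji
      exact ⟨j, ih (by simpa using hj)⟩
    · exact ⟨j, by simpa [hji] using hj⟩

theorem rtg_mem {s t : L.Term W} (h : ReflTransGen (St R) s t) {w : W} (hw : Mem w t) :
    Mem w s :=
  rtg_invariant (I := fun u => Mem w u → Mem w s) (fun _ _ h1 h2 h3 => h1 (h2.mem h3)) id h hw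

end Rewriting

/-! ### Sort constraints and their preservation under rewriting. -/

section Sorting

variable {L : FirstOrder.Language} {V W Y M : Type*} {S : Type*} [PartialOrder S]
variable {A : SortAttachment L V S} {R : TRS L V}

theorem sorted_eval {F : ∀ {n}, L.Functions n → (Fin n → M) → M} {Q : M → S → Prop}
    (hQ : ∀ {n} (f : L.Functions n) ms α,
      Q (F f ms) α ↔ A.resSort f ≤ α ∧ ∀ i, Q (ms i) (A.argSort f i))
    (mono : ∀ m α β, α ≤ β → Q m α → Q m β) {σ : V → M} {t : L.Term V} {α β : S}
    (ht : HasSort A t β) (hle : β ≤ α) (hσ : ∀ x, Mem x t → Q (σ x) (A.varSort x)) :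
    Q (eval F σ t) α := by
  induction ht generalizing α with
  | var x => exact mono _ _ _ hle (hσ x rfl)
  | func f ts β h hβ ih =>
    exact (hQ f _ α).2 ⟨hle, fun i => ih i (hβ i) fun x hx => hσ x ⟨i, hx⟩⟩

/-- Strictness is what allows reading the sort of an instance off its position: the argument sort
there is exactly the sort of the variable. -/
theorem sorted_of_eval {F : ∀ {n}, L.Functions n → (Fin n → M) → M} {Q : M → S → Prop}
    (hQ : ∀ {n} (f : L.Functions n) ms α,
      Q (F f ms) α ↔ A.resSort f ≤ α ∧ ∀ i, Q (ms i) (A.argSort f i))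
    {σ : V → M} {t : L.Term V} {α : S} (ht : StrictVars A t)
    (hv : ∀ x, t = .var x → α = A.varSort x) (h : Q (eval F σ t) α) {x : V} (hx : Mem x t) :
    Q (σ x) (A.varSort x) := by
  induction t generalizing α with
  | var y =>
    obtain rfl : y = x := hx
    rwa [← hv y rfl]
  | func f ts ih =>
    obtain ⟨i, hi⟩ := hx
    exact ih i (ht i).2 (ht i).1 (((hQ f _ α).1 h).2 i) hi

/-- Subject reduction at the root. The carrier `M` is abstract because the result serves both plain
and marked terms. -/
theorem sorted_rule {F : ∀ {n}, L.Functions n → (Fin n → M) → M} {Q : M → S → Prop}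
    (hQ : ∀ {n} (f : L.Functions n) ms α,
      Q (F f ms) α ↔ A.resSort f ≤ α ∧ ∀ i, Q (ms i) (A.argSort f i))
    (mono : ∀ m α β, α ≤ β → Q m α → Q m β) (hR : R.Compatible A) {l r : L.Term V}
    (h : (l, r) ∈ R.rules) {σ : V → M} {α : S} (hl : Q (eval F σ l) α) :
    Q (eval F σ r) α := by
  obtain ⟨⟨γ, β, hlγ, hrβ, hle⟩, -, hst⟩ := hR l r h
  have hγ : γ ≤ α := by
    cases hlγ with
    | var x => exact absurd rfl (R.lhs_not_var _ _ h x)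
    | func f ts β h hβ => exact ((hQ f _ α).1 hl).1
  exact sorted_eval hQ mono hrβ (hle.trans hγ) fun x hx =>
    sorted_of_eval hQ hst (fun y hy => absurd hy (R.lhs_not_var _ _ h y)) hl (R.mem_of_mem h hx)

variable (A) in
/-- A term that may be used at a position of sort `α`, where `P` tells at positions of which sorts
a variable may be used. -/
def Fit (P : W → S → Prop) : L.Term W → S → Prop
  | .var w, α => P w α
  | .func f ts, α => A.resSort f ≤ α ∧ ∀ i, Fit P (ts i) (A.argSort f i)

theorem Fit.mono {P : W → S → Prop} (hP : ∀ w α β, α ≤ β → P w α → P w β) (t : L.Term W)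
    (α β : S) (h : α ≤ β) (ht : Fit A P t α) : Fit A P t β := by
  cases t with
  | var w => exact hP w α β h ht
  | func f ts => exact ⟨ht.1.trans h, ht.2⟩

theorem Fit.imp {P Q : W → S → Prop} (hPQ : ∀ w α, P w α → Q w α) {t : L.Term W} {α : S}
    (ht : Fit A P t α) : Fit A Q t α := by
  induction t generalizing α with
  | var w => exact hPQ w α ht
  | func f ts ih => exact ⟨ht.1, fun i => ih i (ht.2 i)⟩

theorem St.fit {P : W → S → Prop} (hP : ∀ w α β, α ≤ β → P w α → P w β) (hR : R.Compatible A)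
    {s t : L.Term W} (h : St R s t) {α : S} (hs : Fit A P s α) : Fit A P t α := by
  induction h generalizing α with
  | root h σ =>
    rw [subst_eq_eval] at hs ⊢
    exact sorted_rule (fun _ _ _ => Iff.rfl) (Fit.mono hP) hR h hs
  | arg f ts i h ih =>
    refine ⟨hs.1, fun j => ?_⟩
    by_cases hji : j = i
    · subst hji
      simpa using ih (hs.2 j)
    · simpa [hji] using hs.2 j

theorem rtg_fit {P : W → S → Prop} (hP : ∀ w α β, α ≤ β → P w α → P w β) (hR : R.Compatible A)
    {s t : L.Term W} (h : ReflTransGen (St R) s t) {α : S} (hs : Fit A P s α) : Fit A P t α :=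
  rtg_invariant (I := fun u => Fit A P u α) (fun _ _ h1 h2 => h2.fit hP hR h1) hs h

theorem fit_subst_var {P : Y → S → Prop} {ρ : W → Y} {t : L.Term W} {α : S} :
    Fit A P (t.subst fun w => .var (ρ w)) α ↔ Fit A (fun w => P (ρ w)) t α := by
  induction t generalizing α with
  | var w => rfl
  | func f ts ih => simp [Fit, Term.subst, ih]

theorem exists_hasSort_of_fit {t : L.Term V} {α : S}
    (h : Fit A (fun x α => A.varSort x ≤ α) t α) : ∃ β ≤ α, HasSort A t β := by
  induction t generalizing α with
  | var x => exact ⟨_, h, .var x⟩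
  | func f ts ih =>
    choose β h1 h2 using fun i => ih i (h.2 i)
    exact ⟨_, h.1, .func f ts β h2 h1⟩

theorem exists_sort_preserving_injOn {L : FirstOrder.Language} {V S Y : Type*}
    (A : SortAttachment L V S) (s : Y → S) {F : Set Y}
    (hF : F.Finite) : ∃ ρ : Y → V, (∀ y, A.varSort (ρ y) = s y) ∧ Set.InjOn ρ F := by
  classical
  induction F, hF using Set.Finite.induction_on with
  | empty =>
    choose ρ h using fun y => (A.infinite_vars (s y)).nonempty
    exact ⟨ρ, h, by simp⟩
  | @insert y F hy hF ih =>
    obtain ⟨ρ, h1, h2⟩ := ih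
    obtain ⟨v, hv, hv'⟩ := (A.infinite_vars (s y)).exists_notMem_finite (hF.image ρ)
    refine ⟨Function.update ρ y v, fun z => ?_, ?_⟩
    · by_cases hz : z = y
      · subst hz; simpa using hv
      · simpa [hz] using h1 z
    · rw [Set.injOn_insert hy]
      refine ⟨fun a ha b hb hab => ?_, ?_⟩
      · have ha' : a ≠ y := fun h => hy (h ▸ ha)
        have hb' : b ≠ y := fun h => hy (h ▸ hb)
        exact h2 ha hb (by simpa [ha', hb'] using hab)
      · rintro ⟨a, ha, hab⟩
        have ha' : a ≠ y := fun h => hy (h ▸ ha)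
        exact hv' ⟨a, ha, by simpa [ha'] using hab⟩

/-- Confluence on order-sorted terms does not depend on the choice of the variables. -/
theorem confAt_of_fit_sorted (hc : ConfluentOn (Step R.rules) (sortedTerms A)) (s : Y → S)
    {t : L.Term Y} {α : S} (ht : Fit A (fun y α => s y ≤ α) t α) : ConfAt (St R) t := by
  classical
  obtain ⟨ρ, h1, h2⟩ := exists_sort_preserving_injOn A s (finite_mem t)
  intro b c hb hc'
  -- Inverse of the renaming on the variables of `t`; rewriting introduces no new ones, and the
  -- value `t` elsewhere is arbitrary.
  let τ : V → L.Term Y := fun v =>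
    if h : ∃ y, Mem y t ∧ ρ y = v then .var h.choose else t
  have hinv : ∀ u : L.Term Y, ReflTransGen (St R) t u →
      (u.subst fun w => .var (ρ w)).subst τ = u := by
    intro u hu
    rw [subst_comp]
    refine (subst_congr fun y hy => ?_).trans (subst_var u)
    have h : ∃ z, Mem z t ∧ ρ z = ρ y := ⟨y, rtg_mem hu hy, rfl⟩
    simp only [Term.subst, τ, dif_pos h]
    exact congrArg _ (h2 h.choose_spec.1 (rtg_mem hu hy) h.choose_spec.2)
  have hsorted : t.subst (fun w => .var (ρ w)) ∈ sortedTerms A := by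
    obtain ⟨β, -, h⟩ := exists_hasSort_of_fit (A := A) (α := α)
      (t := t.subst fun w => .var (ρ w)) (by
        rw [fit_subst_var (P := fun x α => A.varSort x ≤ α)]; simpa only [h1] using ht)
    exact ⟨β, h⟩
  have hlift : ∀ u : L.Term Y, ReflTransGen (St R) t u →
      ReflTransGen (fun a b => a ∈ sortedTerms A ∧ b ∈ sortedTerms A ∧ Step R.rules a b)
        (t.subst fun w => .var (ρ w)) (u.subst fun w => .var (ρ w)) := by
    intro u hu
    have := rtg_subst hu (fun w => .var (ρ w) : Y → L.Term V)
    refine (rtg_restrict (I := (· ∈ sortedTerms A))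
      (fun a b ha h => hc.1 a b ha (st_iff_step.1 h)) hsorted this).lift id ?_
    exact fun a b ⟨ha, h⟩ => ⟨ha, hc.1 a b ha (st_iff_step.1 h), st_iff_step.1 h⟩
  obtain ⟨d, hd₁, hd₂⟩ := hc.2 _ _ _ (hlift b hb) (hlift c hc')
  have hback : ∀ u : L.Term Y, ReflTransGen (St R) t u →
      ReflTransGen (fun a b => a ∈ sortedTerms A ∧ b ∈ sortedTerms A ∧ Step R.rules a b)
        (u.subst fun w => .var (ρ w)) d → ReflTransGen (St R) u (d.subst τ) := by
    intro u hu h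
    have h' : ReflTransGen (St R) (u.subst fun w => .var (ρ w)) d :=
      h.lift id fun _ _ h => st_iff_step.2 h.2.2
    simpa only [hinv u hu] using rtg_subst h' τ
  exact ⟨_, hback b hb hd₁, hback c hc' hd₂⟩

end Sorting
end OrderSorted

namespace OrderSorted

open FirstOrder.Language (Term LHom)
open Relation (ReflTransGen TransGen)

/-! ### Folding over layers; labelling variables by the sorts of their positions. -/

section LayerFold

variable {L : FirstOrder.Language} {V W Y M : Type*} {S : Type*} [PartialOrder S]
variable {A : SortAttachment L V S} {R : TRS L V}

open Classical in
variable (A) in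
/-- Evaluation of a term that is used at a position of sort `α`; `h` is applied at every proper
subterm that violates the sort constraints. -/
noncomputable def layerFold (F : ∀ {n}, L.Functions n → (Fin n → M) → M) (v : S → W → M)
    (h : S → L.Term W → M → M) : S → L.Term W → M
  | α, .var w => v α w
  | α, .func f ts =>
    if A.resSort f ≤ α then F f fun i => layerFold F v h (A.argSort f i) (ts i)
    else h α (.func f ts) (F f fun i => layerFold F v h (A.argSort f i) (ts i))

section

variable {F : ∀ {n}, L.Functions n → (Fin n → M) → M} {v : S → W → M} {h : S → L.Term W → M → M}

theorem layerFold_of_le {n : ℕ} {f : L.Functions n} {ts : Fin n → L.Term W} {α : S}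
    (hf : A.resSort f ≤ α) : layerFold A F v h α (.func f ts) =
      F f fun i => layerFold A F v h (A.argSort f i) (ts i) := by
  rw [layerFold, if_pos hf]

theorem layerFold_of_not_le {n : ℕ} {f : L.Functions n} {ts : Fin n → L.Term W} {α : S}
    (hf : ¬ A.resSort f ≤ α) : layerFold A F v h α (.func f ts) =
      h α (.func f ts) (F f fun i => layerFold A F v h (A.argSort f i) (ts i)) := by
  rw [layerFold, if_neg hf]

/-- A strictly sorted pattern lies inside a single layer, so the fold meets no violation before
reaching the substituted terms, and reaches them at the sorts of their variables. -/
theorem layerFold_subst {t : L.Term V} {α β : S} (ht : HasSort A t β) (hst : StrictVars A t)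
    (hle : β ≤ α) (hv : ∀ x, t = .var x → α = A.varSort x) (σ : V → L.Term W) :
    layerFold A F v h α (t.subst σ) =
      eval F (fun x => layerFold A F v h (A.varSort x) (σ x)) t := by
  induction ht generalizing α with
  | var x => rw [hv x rfl]; rfl
  | func f ts β _ hβ ih =>
    rw [Term.subst, layerFold_of_le hle, eval]
    congr 1
    funext i
    exact ih i (hst i).2 (hβ i) (hst i).1

end

theorem TRS.Compatible.exists_sort (hR : R.Compatible A) {l r : L.Term V}
    (h : (l, r) ∈ R.rules) : ∃ γ, HasSort A l γ := by
  obtain ⟨⟨γ, -, hγ, -⟩, -⟩ := hR l r h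
  exact ⟨γ, hγ⟩

theorem layerFold_lhs {F : ∀ {n}, L.Functions n → (Fin n → M) → M} {v : S → W → M}
    {h : S → L.Term W → M → M} (hR : R.Compatible A) {l r : L.Term V} (hlr : (l, r) ∈ R.rules)
    {α γ : S} (hl : HasSort A l γ) (hle : γ ≤ α) (σ : V → L.Term W) :
    layerFold A F v h α (l.subst σ) =
      eval F (fun x => layerFold A F v h (A.varSort x) (σ x)) l :=
  layerFold_subst hl (hR l r hlr).2.2 hle (fun x hx => absurd hx (R.lhs_not_var _ _ hlr x)) σ

theorem HasSort.unique {t : L.Term V} {α β : S} (h₁ : HasSort A t α) (h₂ : HasSort A t β) :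
    α = β := by
  cases h₁ <;> cases h₂ <;> rfl

theorem layerFold_rhs {F : ∀ {n}, L.Functions n → (Fin n → M) → M} {v : S → W → M}
    {h : S → L.Term W → M → M} (hR : R.StronglyCompatible A) {l r : L.Term V}
    (hlr : (l, r) ∈ R.rules) {α γ : S} (hl : HasSort A l γ) (hle : γ ≤ α)
    (σ : V → L.Term W) :
    layerFold A F v h α (r.subst σ) =
      eval F (fun x => layerFold A F v h (A.varSort x) (σ x)) r := by
  obtain ⟨⟨γ', β, hl', hr, hβ⟩, -⟩ := hR.1 l r hlr
  obtain rfl := hl.unique hl'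
  -- A collapsing rule leaves the instance of `x` at a position of sort `α`, perhaps above the sort
  -- of `x`; maximality of that sort forces equality.
  by_cases hvar : ∃ x, r = .var x
  · obtain ⟨x, rfl⟩ := hvar
    cases hr
    have hmax := (hR.2 _ _ hlr).1 x rfl
    refine layerFold_subst (.var x) trivial (hβ.trans hle) (fun y hy => ?_) σ
    cases hy
    exact le_antisymm (hmax (hβ.trans hle)) (hβ.trans hle)
  · have hnv : ∀ x, r ≠ .var x := fun x hx => hvar ⟨x, hx⟩
    exact layerFold_subst hr ((hR.2 l r hlr).2 hnv).2 (hβ.trans hle)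
      (fun x hx => absurd hx (hnv x)) σ

theorem Fit.sort_le {P : W → S → Prop} {l r : L.Term V} (hlr : (l, r) ∈ R.rules) {α γ : S}
    (hl : HasSort A l γ) {σ : V → L.Term W} (h : Fit A P (l.subst σ) α) : γ ≤ α := by
  cases hl with
  | var x => exact absurd rfl (R.lhs_not_var _ _ hlr x)
  | func f ts β _ _ => exact h.1

/-- Relabelling of variables depending on the sort of their positions. -/
noncomputable abbrev sortLabel (A : SortAttachment L V S) (μ : S → W → Y) (α : S) (t : L.Term W) :
    L.Term Y :=
  layerFold A (fun f ts => .func f ts) (fun α w => .var (μ α w)) (fun _ _ m => m) α t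

theorem sortLabel_func (μ : S → W → Y) (α : S) {n : ℕ} (f : L.Functions n) (ts : Fin n → L.Term W) :
    sortLabel A μ α (.func f ts) = .func f fun i => sortLabel A μ (A.argSort f i) (ts i) := by
  by_cases hf : A.resSort f ≤ α
  · exact layerFold_of_le hf
  · exact layerFold_of_not_le hf

theorem sortLabel_fit {μ : S → W → Y} {P : W → S → Prop} {Q : Y → S → Prop}
    (hPQ : ∀ w α, P w α → Q (μ α w) α) {t : L.Term W} {α : S} (h : Fit A P t α) :
    Fit A Q (sortLabel A μ α t) α := by
  induction t generalizing α with
  | var w => exact hPQ w α h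
  | func f ts ih =>
    rw [sortLabel_func]
    exact ⟨h.1, fun i => ih i (h.2 i)⟩

theorem subst_sortLabel {μ : S → W → Y} {π : Y → W} {P : W → S → Prop}
    (hπ : ∀ w α, P w α → π (μ α w) = w) {t : L.Term W} {α : S} (h : Fit A P t α) :
    (sortLabel A μ α t).subst (fun y => .var (π y)) = t := by
  induction t generalizing α with
  | var w => exact congrArg Term.var (hπ w α h)
  | func f ts ih =>
    rw [sortLabel_func, Term.subst]
    congr 1
    funext i
    exact ih i (h.2 i)

/-- Canonical labels depend only on the position's sort, so equal subterms matched by a repeated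
variable, whose occurrences in a left-hand side all have one sort, get equal labels. The result `s`
need not be canonically labelled, as the step may move variables to other sorts. -/
theorem sortLabel_step {μ : S → W → Y} {π : Y → W} {P : W → S → Prop}
    (hπ : ∀ w α, P w α → π (μ α w) = w) (hR : R.Compatible A) {t t' : L.Term W}
    (h : St R t t') {α : S} (ht : Fit A P t α) :
    ∃ s, St R (sortLabel A μ α t) s ∧ s.subst (fun y => .var (π y)) = t' := by
  induction h generalizing α with
  | @root l r hlr σ =>
    obtain ⟨γ, hγ⟩ := hR.exists_sort hlr
    have hle := ht.sort_le hlr hγ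
    have hσ : ∀ x, Mem x l → Fit A P (σ x) (A.varSort x) := by
      rw [subst_eq_eval] at ht
      intro x hx
      exact sorted_of_eval (Q := Fit A P) (fun _ _ _ => Iff.rfl) (hR l r hlr).2.2
        (fun y hy => absurd hy (R.lhs_not_var _ _ hlr y)) ht hx
    refine ⟨r.subst fun x => sortLabel A μ (A.varSort x) (σ x), ?_, ?_⟩
    · rw [sortLabel, layerFold_lhs hR hlr hγ hle, ← subst_eq_eval]
      exact .root hlr _
    · rw [subst_comp]
      exact subst_congr fun x hx => subst_sortLabel hπ (hσ x (R.mem_of_mem hlr hx))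
  | arg f ts i h ih =>
    obtain ⟨s, hs, hs'⟩ := ih (ht.2 i)
    rw [sortLabel_func]
    refine ⟨_, .arg f _ i hs, ?_⟩
    rw [Term.subst, update_map (fun _ (u : L.Term Y) => u.subst fun y => .var (π y)), hs']
    congr 2
    funext j
    exact subst_sortLabel hπ (ht.2 j)

/-- Here the right-hand side also lies in one layer, so canonical labels stay canonical. -/
theorem sortLabel_step_of_stronglyCompatible {μ : S → W → Y} {P : W → S → Prop}
    (hR : R.StronglyCompatible A) {t t' : L.Term W} (h : St R t t') {α : S}
    (ht : Fit A P t α) : St R (sortLabel A μ α t) (sortLabel A μ α t') := by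
  induction h generalizing α with
  | @root l r hlr σ =>
    obtain ⟨γ, hγ⟩ := hR.1.exists_sort hlr
    have hle := ht.sort_le hlr hγ
    rw [sortLabel, sortLabel, layerFold_lhs hR.1 hlr hγ hle, layerFold_rhs hR hlr hγ hle,
      ← subst_eq_eval, ← subst_eq_eval]
    exact .root hlr _
  | arg f ts i h ih =>
    rw [sortLabel_func, sortLabel_func, update_map (fun j u => sortLabel A μ (A.argSort f j) u)]
    exact .arg f _ i (ih (ht.2 i))

/-- Linear matching never compares subterms, so identifying variables creates no redex. -/
theorem linear_lift {π : Y → W} (hR : R.LeftLinear) {t t' : L.Term W} (h : St R t t')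
    {s : L.Term Y} (hs : s.subst (fun y => .var (π y)) = t) :
    ∃ s', St R s s' ∧ s'.subst (fun y => .var (π y)) = t' := by
  have inv : ∀ {n} (f : L.Functions n) (ts : Fin n → L.Term W) (u : L.Term Y),
      u.subst (fun y => .var (π y)) = .func f ts →
      ∃ us, u = .func f us ∧ ∀ i, (us i).subst (fun y => .var (π y)) = ts i := by
    intro n f ts u hu
    cases u with
    | var y => simp [Term.subst] at hu
    | func g us =>
      rw [Term.subst] at hu
      cases hu
      exact ⟨us, rfl, fun _ => rfl⟩
  induction h generalizing s with
  | @root l r hlr σ =>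
    rw [subst_eq_eval σ] at hs
    obtain ⟨τ, h1, h2⟩ := (hR l r hlr).match (G := fun f ts => Term.func f ts)
      (E := fun (t : L.Term W) (u : L.Term Y) => u.subst (fun y => .var (π y)) = t) inv hs
    rw [← subst_eq_eval] at h1
    refine ⟨r.subst τ, h1 ▸ .root hlr τ, ?_⟩
    rw [subst_comp]
    exact subst_congr fun x hx => h2 x (R.mem_of_mem hlr hx)
  | arg f ts i h ih =>
    obtain ⟨us, rfl, hus⟩ := inv f ts s hs
    obtain ⟨s', h1, h2⟩ := ih (hus i)
    refine ⟨_, .arg f us i h1, ?_⟩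
    rw [Term.subst, update_map (fun _ (u : L.Term Y) => u.subst fun y => .var (π y)), h2]
    congr 2
    funext j
    exact hus j

theorem confAt_of_fit_of_leftLinear (hc : ConfluentOn (Step R.rules) (sortedTerms A))
    (hR : R.LeftLinear) {t : L.Term W} {α : S} (ht : Fit A (fun _ _ => True) t α) :
    ConfAt (St R) t := by
  set s : L.Term (W × S) := sortLabel A (fun α w => (w, α)) α t with hs
  have hst : s.subst (fun y => .var y.1) = t :=
    subst_sortLabel (P := fun _ _ => True) (fun _ _ _ => rfl) ht
  have hlift : ∀ b, ReflTransGen (St R) t b →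
      ∃ s', ReflTransGen (St R) s s' ∧ s'.subst (fun y => .var y.1) = b := by
    intro b hb
    induction hb with
    | refl => exact ⟨s, .refl, hst⟩
    | tail _ h ih =>
      obtain ⟨s', h1, h2⟩ := ih
      obtain ⟨s'', h3, h4⟩ := linear_lift hR h h2
      exact ⟨s'', h1.tail h3, h4⟩
  intro b c hb hc'
  obtain ⟨b', hb₁, rfl⟩ := hlift b hb
  obtain ⟨c', hc₁, rfl⟩ := hlift c hc'
  obtain ⟨d, h1, h2⟩ := confAt_of_fit_sorted hc (fun y : W × S => y.2)
    (sortLabel_fit (Q := fun (y : W × S) α => y.2 ≤ α) (fun _ _ _ => le_rfl) ht) b' c' hb₁ hc₁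
  exact ⟨_, rtg_subst h1 _, rtg_subst h2 _⟩

theorem confAt_of_fit_of_stronglyCompatible
    (hc : ConfluentOn (Step R.rules) (sortedTerms A)) (hR : R.StronglyCompatible A)
    {t : L.Term W} {α : S} (ht : Fit A (fun _ _ => True) t α) : ConfAt (St R) t := by
  have hlift : ∀ b, ReflTransGen (St R) t b → Fit A (fun _ _ => True) b α ∧
      ReflTransGen (St R) (sortLabel A (fun α w => (w, α)) α t)
        (sortLabel A (fun α w => (w, α)) α b) := by
    intro b hb
    induction hb with
    | refl => exact ⟨ht, .refl⟩
    | tail _ h ih => exact ⟨h.fit (fun _ _ _ _ => id) hR.1 ih.1,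
        ih.2.tail (sortLabel_step_of_stronglyCompatible hR h ih.1)⟩
  intro b c hb hc'
  obtain ⟨hb₁, hb₂⟩ := hlift b hb
  obtain ⟨hc₁, hc₂⟩ := hlift c hc'
  obtain ⟨d, h1, h2⟩ := confAt_of_fit_sorted hc (fun y : W × S => y.2)
    (sortLabel_fit (Q := fun (y : W × S) α => y.2 ≤ α) (fun _ _ _ => le_rfl) ht) _ _ hb₂ hc₂
  have key : ∀ {u}, Fit A (fun _ _ => True) u α →
      (sortLabel A (fun α w => (w, α)) α u).subst (fun y : W × S => .var y.1) = u := fun hu =>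
    subst_sortLabel (P := fun _ _ => True) (fun _ _ _ => rfl) hu
  have h1' := rtg_subst h1 fun y : W × S => Term.var y.1
  have h2' := rtg_subst h2 fun y : W × S => Term.var y.1
  rw [key hb₁] at h1'
  rw [key hc₁] at h2'
  exact ⟨_, h1', h2'⟩

end LayerFold
end OrderSorted

namespace OrderSorted

open FirstOrder.Language (Term LHom)
open Relation (ReflTransGen TransGen)

theorem transGen_pointwise {X Y : Type*} {n : ℕ} {r : X → X → Prop} {s : Y → Y → Prop}
    (g : (Fin n → X) → Y)
    (hg : ∀ ts i t, r (ts i) t → s (g ts) (g (Function.update ts i t))) {ts us : Fin n → X}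
    (h : ∀ i, ReflTransGen r (ts i) (us i)) {i : Fin n} (hi : TransGen r (ts i) (us i)) :
    TransGen s (g ts) (g us) := by
  classical
  have one : ∀ t, TransGen r (ts i) t → TransGen s (g ts) (g (Function.update ts i t)) := by
    intro t h
    induction h with
    | single h => exact .single (hg _ _ _ h)
    | tail _ h ih =>
      refine ih.tail ?_
      have := hg (Function.update ts i _) i _ (by rw [Function.update_self]; exact h)
      rwa [Function.update_idem] at this
  refine (one _ hi).trans_left (rtg_pointwise g hg fun j => ?_)
  by_cases hj : j = i
  · subst hj; simpa using ReflTransGen.refl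
  · simpa [hj] using h j

/-! ### Coding natural numbers by diamonds, to exploit bounded duplication. -/

section Diamond

universe u v w

variable {L : FirstOrder.Language.{u, v}} {V : Type w} {W : Type*} {R : TRS L V}

/-- A function symbol of `L` as an operation on terms over the extended signature. -/
def dfunc {n : ℕ} (f : L.Functions n) (ts : Fin n → (withDiamond L).Term V) :
    (withDiamond L).Term V :=
  Term.func (L := withDiamond L) (Sum.inl f) ts

theorem onTerm_subst (σ : V → (withDiamond L).Term V) (t : L.Term V) :
    ((LHom.sumInl : L →ᴸ withDiamond L).onTerm t).subst σ = eval dfunc σ t := by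
  induction t with
  | var x => rfl
  | func f ts ih =>
    simp only [LHom.onTerm, Term.subst, eval, dfunc]
    congr 1
    funext i
    exact ih i

theorem step_eval {l r : L.Term V} (h : (l, r) ∈ R.rules) (σ : V → (withDiamond L).Term V) :
    Step R.liftRules (eval dfunc σ l) (eval dfunc σ r) := by
  rw [← onTerm_subst, ← onTerm_subst]
  exact Step.root (R := R.liftRules) ⟨l, r, h, rfl⟩ σ

theorem step_diamond (x : V) (t : (withDiamond L).Term V) :
    Step diamondRules (diamondTerm t) t :=
  Step.root (R := diamondRules) (l := diamondTerm (.var x)) (r := .var x) ⟨x, rfl⟩ fun _ => t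

theorem step_dfunc {rs : Set ((withDiamond L).Term V × (withDiamond L).Term V)} {n : ℕ}
    (f : L.Functions n) (ts : Fin n → (withDiamond L).Term V) (i : Fin n)
    (t : (withDiamond L).Term V) (h : Step rs (ts i) t) :
    Step rs (dfunc f ts) (dfunc f (Function.update ts i t)) :=
  Step.arg (L := withDiamond L) _ ts i h

theorem step_diamondTerm {rs : Set ((withDiamond L).Term V × (withDiamond L).Term V)}
    {t t' : (withDiamond L).Term V} (h : Step rs t t') :
    Step rs (diamondTerm t) (diamondTerm t') := by
  have := Step.arg (L := withDiamond L) (R := rs) (n := 1) (Sum.inr DiamondFun.diamond)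
    (fun _ => t) 0 h
  rwa [show Function.update (fun _ : Fin 1 => t) 0 t' = fun _ => t' from
    funext fun i => by rw [Subsingleton.elim i 0, Function.update_self]] at this

theorem transGen_relative {X : Type*} {r s : X → X → Prop} {a b c : X}
    (h₁ : ReflTransGen s a b) (h₂ : TransGen r b c) : TransGen (Relative r s) a c := by
  induction h₂ with
  | single h => exact .single ⟨_, _, h₁, h, .refl⟩
  | tail _ h ih => exact ih.tail ⟨_, _, .refl, h, .refl⟩

/-- The variable `w` is replaced by `ν w` diamonds. -/
noncomputable def diamondCode (ν : W → ℕ) (x : V) (t : L.Term W) : (withDiamond L).Term V :=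
  eval dfunc (fun w => diamondTerm^[ν w] (.var x)) t

theorem diamondCode_step (ν : W → ℕ) (x : V) {s t : L.Term W} (h : St R s t) :
    Step R.liftRules (diamondCode ν x s) (diamondCode ν x t) := by
  induction h with
  | root h σ => simpa only [diamondCode, eval_subst] using step_eval h _
  | arg f ts i h ih =>
    change Step _ _ (dfunc f fun j => diamondCode ν x (Function.update ts i _ j))
    rw [update_map (fun _ u => diamondCode ν x u)]
    exact step_dfunc f _ i _ ih

theorem transGen_iterate_diamondTerm (x : V) (t : (withDiamond L).Term V) {m n : ℕ} (h : n < m) :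
    TransGen (Step diamondRules) (diamondTerm^[m] t) (diamondTerm^[n] t) := by
  induction m, h using Nat.le_induction with
  | base =>
    rw [Function.iterate_succ_apply']
    exact .single (step_diamond x _)
  | succ m _ ih =>
    rw [Function.iterate_succ_apply']
    exact ih.head (step_diamond x _)

theorem eq_or_transGen_func {X : Type*} {n : ℕ} (f : L.Functions n)
    (code : X → (withDiamond L).Term V) (ts us : Fin n → X)
    (h : ∀ i, ts i = us i ∨ TransGen (Step diamondRules) (code (ts i)) (code (us i))) :
    ts = us ∨ TransGen (Step diamondRules) (dfunc f fun i => code (ts i))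
      (dfunc f fun i => code (us i)) := by
  by_cases heq : ∀ i, ts i = us i
  · exact .inl (funext heq)
  · push Not at heq
    obtain ⟨i, hi⟩ := heq
    refine .inr (transGen_pointwise (dfunc f) (step_dfunc f) (fun j => ?_)
      ((h i).resolve_left hi))
    rcases h j with hj | hj
    · rw [hj]
    · exact hj.to_reflTransGen

end Diamond

/-! ### From order-sorted variables to variables at arbitrary positions. -/

section Sorted

variable {L : FirstOrder.Language} {V W : Type*} {S : Type*} [PartialOrder S]
variable {A : SortAttachment L V S} {R : TRS L V}

/-- The labels in `F` are numbered injectively by `ν`, and `μ α w` is the admissible label of `w`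
with least number; relabelling to it therefore either changes nothing or lowers the number. -/
theorem exists_minimal_label {F : Set (W × S)} (hF : F.Finite) :
    ∃ (ν : W × S → ℕ) (μ : S → W → W × S), ∀ y α, y ∈ F → y.2 ≤ α →
      μ α y.1 ∈ F ∧ (μ α y.1).1 = y.1 ∧ (μ α y.1).2 ≤ α ∧
        (y = μ α y.1 ∨ ν (μ α y.1) < ν y) := by
  classical
  obtain ⟨ν, hν⟩ := Set.countable_iff_exists_injOn.1 hF.countable
  have key : ∀ α w, ∃ z : W × S, ∀ y, y ∈ F → y.2 ≤ α → y.1 = w →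
      z ∈ F ∧ z.1 = w ∧ z.2 ≤ α ∧ (y = z ∨ ν z < ν y) := by
    intro α w
    by_cases hne : ∃ y, y ∈ F ∧ y.2 ≤ α ∧ y.1 = w
    · obtain ⟨z, hz, hmin⟩ := Set.exists_min_image {y | y ∈ F ∧ y.2 ≤ α ∧ y.1 = w} ν
        (hF.subset fun _ h => h.1) hne
      refine ⟨z, fun y h1 h2 h3 => ⟨hz.1, hz.2.2, hz.2.1, ?_⟩⟩
      rcases (hmin y ⟨h1, h2, h3⟩).lt_or_eq with h | h
      · exact .inr h
      · exact .inl (hν h1 hz.1 h.symm)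
    · exact ⟨(w, α), fun y h1 h2 h3 => absurd ⟨y, h1, h2, h3⟩ hne⟩
  choose μ hμ using key
  exact ⟨ν, μ, fun y α h1 h2 => hμ α y.1 y h1 h2 rfl⟩

/-- An instance of `confAt_of_normalize`: erasure forgets labels, normalization picks minimal
admissible ones. With `ν y` diamonds in place of the variable `y`, rewriting is simulated by the
lifted rules and a proper relabelling removes diamonds, so bounded duplication supplies the
well-founded order. -/
theorem confAt_of_fit_of_boundedDuplicating
    (hc : ConfluentOn (Step R.rules) (sortedTerms A)) (hcomp : R.Compatible A)
    (hR : R.BoundedDuplicating) {t : L.Term W} {α : S} (ht : Fit A (fun _ _ => True) t α) :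
    ConfAt (St R) t := by
  obtain ⟨v₀, -⟩ := (A.infinite_vars α).nonempty
  set s : L.Term (W × S) := sortLabel A (fun α w => (w, α)) α t with hs
  have hst : s.subst (fun y => .var y.1) = t :=
    subst_sortLabel (P := fun _ _ => True) (fun _ _ _ => rfl) ht
  obtain ⟨ν, μ, hμ⟩ := exists_minimal_label (finite_mem s)
  set F := {y | Mem y s}
  -- Only labels already present in `s` are admitted, which keeps the supply finite.
  let P : W × S → S → Prop := fun y α => y ∈ F ∧ y.2 ≤ α
  have hP : ∀ y α β, α ≤ β → P y α → P y β := fun y α β h h' => ⟨h'.1, h'.2.trans h⟩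
  let P' : W → S → Prop := fun w α => ∃ y, P y α ∧ y.1 = w
  have hμ' : ∀ w α, P' w α → P (μ α w) α ∧ (μ α w).1 = w := by
    rintro _ α ⟨y, hy, rfl⟩
    obtain ⟨h1, h2, h3, -⟩ := hμ y α hy.1 hy.2
    exact ⟨⟨h1, h3⟩, h2⟩
  have hfit : ∀ {x : L.Term (W × S)} {α}, Fit A P x α →
      Fit A P' (x.subst fun y => .var y.1) α := by
    intro x α h
    induction x generalizing α with
    | var y => exact ⟨y, h, rfl⟩
    | func f ts ih => exact ⟨h.1, fun i => ih i (h.2 i)⟩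
  have hs_fit : ∀ {u : L.Term (W × S)} {β}, (∀ y, Mem y u → Mem y s) →
      Fit A (fun (y : W × S) α => y.2 ≤ α) u β → Fit A P u β := by
    intro u β hmem hu
    induction u generalizing β with
    | var y => exact ⟨hmem y rfl, hu⟩
    | func f ts ih => exact ⟨hu.1, fun i => ih i (fun y hy => hmem y ⟨i, hy⟩) (hu.2 i)⟩
  have hdec : ∀ {x : L.Term (W × S)} {α}, Fit A P x α →
      x = sortLabel A μ α (x.subst fun y => .var y.1) ∨
      TransGen (Step diamondRules) (diamondCode ν v₀ x)
        (diamondCode ν v₀ (sortLabel A μ α (x.subst fun y => .var y.1))) := by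
    intro x α h
    induction x generalizing α with
    | var y =>
      rcases (hμ y α h.1 h.2).2.2.2 with h' | h'
      · exact .inl (congrArg Term.var h')
      · exact .inr (transGen_iterate_diamondTerm v₀ _ h')
    | func f ts ih =>
      rw [Term.subst, sortLabel_func]
      rcases eq_or_transGen_func f (diamondCode ν v₀) ts _ (fun i => ih i (h.2 i)) with h' | h'
      · exact .inl (congrArg _ h')
      · exact .inr h'
  have := confAt_of_normalize (St R) (St R) (fun x : L.Term (W × S) => x.subst fun y => .var y.1)
    (fun x => sortLabel A μ α (x.subst fun y => .var y.1)) (fun x => Fit A P x α)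
    (fun x y hx h => h.fit hP hcomp hx)
    (fun x hx => sortLabel_fit (fun w α h => (hμ' w α h).1) (hfit hx))
    (fun x y h => h.subst _)
    (fun x hx => subst_sortLabel (fun w α h => (hμ' w α h).2) (hfit hx))
    (fun x b hx h => sortLabel_step (fun w α h => (hμ' w α h).2) hcomp h (hfit hx))
    (fun x hx => confAt_of_fit_sorted hc (fun y => y.2) (α := α) (hx.imp fun _ _ h => h.2))
    (fun x y => TransGen (Relative (Step diamondRules) (Step R.liftRules))
      (diamondCode ν v₀ x) (diamondCode ν v₀ y))
    (InvImage.wf (diamondCode ν v₀) hR)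
    (fun x y hx hxy hne => transGen_relative (hxy.lift _ fun _ _ => diamondCode_step ν v₀)
      ((hdec (rtg_fit hP hcomp hxy hx)).resolve_left fun h => hne h.symm))
    s (hs_fit (fun _ => id) (sortLabel_fit (Q := fun (y : W × S) α => y.2 ≤ α)
      (fun _ _ _ => le_rfl) ht))
  simpa only [hst] using this

/-- Confluence on terms whose function symbols respect the sorts, but not necessarily the
variables. -/
theorem confAt_of_fit (hc : ConfluentOn (Step R.rules) (sortedTerms A))
    (hcomp : R.Compatible A)
    (hR : R.LeftLinear ∨ R.BoundedDuplicating ∨ R.StronglyCompatible A) {t : L.Term W} {α : S}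
    (ht : Fit A (fun _ _ => True) t α) : ConfAt (St R) t := by
  rcases hR with hR | hR | hR
  · exact confAt_of_fit_of_leftLinear hc hR ht
  · exact confAt_of_fit_of_boundedDuplicating hc hcomp hR ht
  · exact confAt_of_fit_of_stronglyCompatible hc hR ht

end Sorted
end OrderSorted

/-! ### Marked terms: confluence when every violation carries a mark. -/

namespace OrderSorted

open FirstOrder.Language (Term LHom)
open Relation (ReflTransGen TransGen)

universe u v w

/-- Terms in which subterms may be marked. -/
inductive Marked (L : FirstOrder.Language.{u, v}) (V : Type w) : Type (max u w)
  | var (x : V) : Marked L V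
  | dia (t : Marked L V) : Marked L V
  | func {n : ℕ} (f : L.Functions n) (ts : Fin n → Marked L V) : Marked L V

section Marked

variable {L : FirstOrder.Language.{u, v}} {V : Type w} {W S : Type*} [PartialOrder S]
variable {A : SortAttachment L V S} {R : TRS L V}

/-- Substitution of marked terms for the variables of a term. -/
def evalMarked (σ : W → Marked L V) (t : L.Term W) : Marked L V :=
  eval (fun f ts => .func f ts) σ t

/-- The rewrite relation of `R` on marked terms. -/
inductive MSt (R : TRS L V) : Marked L V → Marked L V → Prop
  | root {l r : L.Term V} (h : (l, r) ∈ R.rules) (σ : V → Marked L V) :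
      MSt R (evalMarked σ l) (evalMarked σ r)
  | arg {n : ℕ} (f : L.Functions n) (ts : Fin n → Marked L V) (i : Fin n) {t : Marked L V}
      (h : MSt R (ts i) t) : MSt R (.func f ts) (.func f (Function.update ts i t))
  | dia {t t' : Marked L V} (h : MSt R t t') : MSt R (.dia t) (.dia t')

variable (A) in
/-- A marked term that may be used at a position of sort `α`. Variables and marked subterms fit
everywhere. -/
def MFit : Marked L V → S → Prop
  | .var _, _ => True
  | .dia t, _ => ∃ β, MFit t β
  | .func f ts, α => A.resSort f ≤ α ∧ ∀ i, MFit (ts i) (A.argSort f i)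

/-- The nesting depth of marks. -/
def Marked.depth : Marked L V → ℕ
  | .var _ => 0
  | .dia t => t.depth + 1
  | .func _ ts => Finset.univ.sup fun i => (ts i).depth

/-- The outermost marked subterms, without their marks. -/
def Marked.marks : Marked L V → Set (Marked L V)
  | .var _ => ∅
  | .dia t => {t}
  | .func _ ts => ⋃ i, (ts i).marks

/-- The unmarked top of a marked term, where marked subterms are abstracted to variables. -/
def Marked.top (r : Marked L V → Marked L V → Prop) : Marked L V → L.Term (V ⊕ Quot r)
  | .var x => .var (.inl x)
  | .dia t => .var (.inr (Quot.mk r t))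
  | .func f ts => .func f fun i => (ts i).top r

theorem MFit.mono (t : Marked L V) (α β : S) (h : α ≤ β) (ht : MFit A t α) : MFit A t β := by
  cases t with
  | var x => trivial
  | dia t => exact ht
  | func f ts => exact ⟨ht.1.trans h, ht.2⟩

theorem MSt.fit (hR : R.Compatible A) {s t : Marked L V} (h : MSt R s t) {α : S}
    (hs : MFit A s α) : MFit A t α := by
  induction h generalizing α with
  | root h σ => exact sorted_rule (Q := MFit A) (fun _ _ _ => Iff.rfl) MFit.mono hR h hs
  | arg f ts i h ih =>
    refine ⟨hs.1, fun j => ?_⟩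
    by_cases hji : j = i
    · subst hji
      simpa using ih (hs.2 j)
    · simpa [hji] using hs.2 j
  | dia h ih =>
    obtain ⟨β, hβ⟩ := hs
    exact ⟨β, ih hβ⟩

theorem rtg_mfit (hR : R.Compatible A) {s t : Marked L V} (h : ReflTransGen (MSt R) s t) {α : S}
    (hs : MFit A s α) : MFit A t α :=
  rtg_invariant (I := fun u => MFit A u α) (fun _ _ h1 h2 => h2.fit hR h1) hs h

theorem depth_evalMarked (σ : W → Marked L V) (t : L.Term W) :
    (evalMarked σ t).depth = eval (fun _ ms => Finset.univ.sup ms) (fun x => (σ x).depth) t :=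
  map_eval Marked.depth (fun _ _ => rfl) σ t

theorem MSt.depth_le {s t : Marked L V} (h : MSt R s t) : t.depth ≤ s.depth := by
  induction h with
  | root h σ =>
    rw [depth_evalMarked, depth_evalMarked, eval_sup_le_iff]
    exact fun x hx => eval_sup_le_iff (σ := fun x => (σ x).depth).1 le_rfl x (R.mem_of_mem h hx)
  | arg f ts i h ih =>
    simp only [Marked.depth, Finset.sup_le_iff]
    intro j _
    refine le_trans ?_ (Finset.le_sup (f := fun i => (ts i).depth) (Finset.mem_univ j))
    by_cases hji : j = i
    · subst hji; simpa using ih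
    · simp [hji]
  | dia h ih => exact Nat.succ_le_succ ih

theorem finite_marks (t : Marked L V) : t.marks.Finite := by
  induction t with
  | var x => exact Set.finite_empty
  | dia t => exact Set.finite_singleton t
  | func f ts ih => exact Set.finite_iUnion ih

theorem top_evalMarked (r : Marked L V → Marked L V → Prop) (σ : W → Marked L V) (t : L.Term W) :
    (evalMarked σ t).top r = t.subst fun x => (σ x).top r := by
  rw [subst_eq_eval]
  exact map_eval (Marked.top r) (fun _ _ => rfl) σ t

theorem top_fit (r : Marked L V → Marked L V → Prop) {t : Marked L V} {α : S}
    (h : MFit A t α) : Fit A (fun _ _ => True) (t.top r) α := by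
  induction t generalizing α with
  | var x => trivial
  | dia t => trivial
  | func f ts ih => exact ⟨h.1, fun i => ih i (h.2 i)⟩

theorem mrtg_func {n : ℕ} (f : L.Functions n) {ts us : Fin n → Marked L V}
    (h : ∀ i, ReflTransGen (MSt R) (ts i) (us i)) :
    ReflTransGen (MSt R) (.func f ts) (.func f us) :=
  rtg_pointwise (Marked.func f) (fun ts i _ h => .arg f ts i h) h

theorem mrtg_dia {t u : Marked L V} (h : ReflTransGen (MSt R) t u) :
    ReflTransGen (MSt R) (.dia t) (.dia u) :=
  h.lift _ fun _ _ h => .dia h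

theorem mrtg_eval {s t : L.Term W} (h : ReflTransGen (St R) s t) (τ : W → Marked L V) :
    ReflTransGen (MSt R) (evalMarked τ s) (evalMarked τ t) := by
  refine h.lift _ fun a b hab => ?_
  induction hab with
  | @root l r h σ =>
    change MSt R (evalMarked τ (l.subst σ)) (evalMarked τ (r.subst σ))
    simpa only [evalMarked, eval_subst] using MSt.root h fun x => evalMarked τ (σ x)
  | arg f ts i h ih =>
    change MSt R _ (.func f fun j => evalMarked τ (Function.update ts i _ j))
    rw [update_map (fun _ u => evalMarked τ u)]
    exact .arg f _ i ih

theorem mrtg_eval_of_forall {t : L.Term W} {σ τ : W → Marked L V}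
    (h : ∀ x, ReflTransGen (MSt R) (σ x) (τ x)) :
    ReflTransGen (MSt R) (evalMarked σ t) (evalMarked τ t) := by
  induction t with
  | var x => exact h x
  | func f ts ih => exact mrtg_func f ih

theorem mrtg_eval_top {r : Marked L V → Marked L V → Prop} {φ : Quot r → Marked L V}
    {t : Marked L V} (h : ∀ u ∈ t.marks, ReflTransGen (MSt R) u (φ (Quot.mk r u))) :
    ReflTransGen (MSt R) t (evalMarked (Sum.elim .var fun c => .dia (φ c)) (t.top r)) := by
  induction t with
  | var x => exact .refl
  | dia t => exact mrtg_dia (h t rfl)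
  | func f ts ih => exact mrtg_func f fun i => ih i fun u hu => h u (Set.mem_iUnion.2 ⟨i, hu⟩)

/-- Confluence on terms in which all violations of the sort constraints are marked. -/
theorem mconfAt_of_mfit (hcomp : R.Compatible A)
    (hconf : ∀ (r : Marked L V → Marked L V → Prop) (t : L.Term (V ⊕ Quot r)) (α : S),
      Fit A (fun _ _ => True) t α → ConfAt (St R) t)
    {t : Marked L V} {α : S} (ht : MFit A t α) : ConfAt (MSt R) t := by
  suffices H : ∀ n (t : Marked L V) α, t.depth < n → MFit A t α → ConfAt (MSt R) t from
    H _ t α (Nat.lt_succ_self _) ht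
  clear ht t α
  intro n
  induction n with
  | zero => intro t α h; omega
  | succ n ih =>
  intro t α hd ht
  let I : Marked L V → Prop := fun a => a.depth < n ∧ ∃ β, MFit A a β
  -- Contents of marks have depth below `n`, so this restricted relation governs them and is
  -- confluent by induction.
  set r : Marked L V → Marked L V → Prop := fun a b => I a ∧ MSt R a b with hr
  have hI : ∀ a b, I a → MSt R a b → I b := fun a b ⟨h1, β, h2⟩ h =>
    ⟨h.depth_le.trans_lt h1, β, h.fit hcomp h2⟩
  have hrc : Confluent r := confluent_restrict hI fun a ⟨h1, β, h2⟩ => ih a β h1 h2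
  have hstep : ∀ {a b : Marked L V}, MSt R a b → ∀ {α}, a.depth ≤ n → MFit A a α →
      ReflTransGen (St R) (a.top r) (b.top r) := by
    intro a b h
    induction h with
    | root h σ =>
      intro _ _ _
      rw [top_evalMarked, top_evalMarked]
      exact .single (.root h _)
    | arg f ts i h ih =>
      intro α hd hf
      refine rtg_func f fun j => ?_
      by_cases hji : j = i
      · subst hji
        rw [Function.update_self]
        exact ih ((Finset.le_sup (f := fun i => (ts i).depth) (Finset.mem_univ j)).trans hd)
          (hf.2 j)
      · rw [Function.update_of_ne hji]
    -- A step under a mark stays within one class, so the top does not change.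
    | dia h _ =>
      intro α hd hf
      refine Eq.subst ?_ ReflTransGen.refl
      exact congrArg (fun c => Term.var (Sum.inr c)) (Quot.sound ⟨⟨hd, hf⟩, h⟩)
  have htop : ∀ b, ReflTransGen (MSt R) t b → b.depth ≤ n ∧ MFit A b α ∧
      ReflTransGen (St R) (t.top r) (b.top r) := by
    intro b hb
    induction hb with
    | refl => exact ⟨Nat.lt_succ_iff.1 hd, ht, .refl⟩
    | tail _ h ih => exact ⟨h.depth_le.trans ih.1, h.fit hcomp ih.2.1,
        ih.2.2.trans (hstep h ih.1 ih.2.1)⟩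
  intro b c hb hc
  obtain ⟨-, -, hb'⟩ := htop b hb
  obtain ⟨-, -, hc'⟩ := htop c hc
  obtain ⟨e, hbe, hce⟩ := hconf r _ α (top_fit r ht) _ _ hb' hc'
  obtain ⟨φ, hφ, hφb⟩ := exists_balanced hrc (finite_marks b)
  obtain ⟨ψ, hψ, hψc⟩ := exists_balanced hrc (finite_marks c)
  -- The two systems of representatives, balanced for `b` and for `c`, are merged classwise.
  choose χ hχ₁ hχ₂ using fun c => joinable_of_quot_eq hrc ((hφ c).trans (hψ c).symm)
  have side : ∀ {b : Marked L V} {φ : Quot r → Marked L V},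
      (∀ u ∈ b.marks, ReflTransGen r u (φ (Quot.mk r u))) →
      ReflTransGen (St R) (b.top r) e → (∀ c, ReflTransGen r (φ c) (χ c)) →
      ReflTransGen (MSt R) b (evalMarked (Sum.elim .var fun c => .dia (χ c)) e) := by
    intro b φ h1 h2 h3
    refine ((mrtg_eval_top fun u hu => rtg_of_restrict (h1 u hu)).trans (mrtg_eval h2 _)).trans
      (mrtg_eval_of_forall ?_)
    rintro (x | c)
    · exact .refl
    · exact mrtg_dia (rtg_of_restrict (h3 c))
  exact ⟨_, side hφb hbe hχ₁, side hψc hce hχ₂⟩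

/-- Removal of all marks. -/
def Marked.erase : Marked L V → L.Term V
  | .var x => .var x
  | .dia t => t.erase
  | .func f ts => .func f fun i => (ts i).erase

/-- The marks that are needed if a term is used at a position of sort `α`. -/
noncomputable abbrev mark (A : SortAttachment L V S) (α : S) (t : L.Term V) : Marked L V :=
  layerFold A (fun f ts => .func f ts) (fun _ x => .var x) (fun _ _ m => .dia m) α t

theorem erase_evalMarked (σ : V → Marked L V) (t : L.Term V) :
    (evalMarked σ t).erase = t.subst fun x => (σ x).erase := by
  rw [subst_eq_eval]
  exact map_eval Marked.erase (fun _ _ => rfl) σ t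

theorem erase_mark (α : S) (t : L.Term V) : (mark A α t).erase = t := by
  induction t generalizing α with
  | var x => rfl
  | func f ts ih =>
    by_cases hf : A.resSort f ≤ α
    · rw [mark, layerFold_of_le hf]; simp [Marked.erase, ih]
    · rw [mark, layerFold_of_not_le hf]; simp [Marked.erase, ih]

theorem mark_fit (α : S) (t : L.Term V) : MFit A (mark A α t) α := by
  induction t generalizing α with
  | var x => trivial
  | func f ts ih =>
    by_cases hf : A.resSort f ≤ α
    · rw [mark, layerFold_of_le hf]
      exact ⟨hf, fun i => ih i _⟩
    · rw [mark, layerFold_of_not_le hf]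
      exact ⟨_, le_rfl, fun i => ih i _⟩

theorem MSt.erase {s t : Marked L V} (h : MSt R s t) : St R s.erase t.erase := by
  induction h with
  | root h σ => rw [erase_evalMarked, erase_evalMarked]; exact .root h _
  | arg f ts i h ih =>
    simp only [Marked.erase]
    rw [update_map (fun _ (u : Marked L V) => u.erase)]
    exact .arg f _ i ih
  | dia h ih => exact ih

/-- The canonical marking never cuts through a left-hand side and marks equal instances equally, so
redexes survive. The reduct may carry superfluous marks, hence the comparison up to `erase`. -/
theorem mark_step (hR : R.Compatible A) {t t' : L.Term V} (h : St R t t') (α : S) :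
    ∃ s, MSt R (mark A α t) s ∧ s.erase = t' := by
  induction h generalizing α with
  | @root l r hlr σ =>
    obtain ⟨γ, hγ⟩ := hR.exists_sort hlr
    have key : ∀ β, γ ≤ β → ∃ s, MSt R (mark A β (l.subst σ)) s ∧ s.erase = r.subst σ := by
      intro β hβ
      refine ⟨evalMarked (fun x => mark A (A.varSort x) (σ x)) r, ?_, ?_⟩
      · rw [mark, layerFold_lhs hR hlr hγ hβ]
        exact .root hlr _
      · simp only [erase_evalMarked, erase_mark]
    by_cases hle : γ ≤ α
    · exact key α hle
    -- The redex itself is a violation at `α`: the step is made at its own sort, beneath the mark.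
    · obtain ⟨s, h1, h2⟩ := key γ le_rfl
      cases hγ with
      | var x => exact absurd rfl (R.lhs_not_var _ _ hlr x)
      | func f ts β _ _ =>
        refine ⟨.dia s, ?_, h2⟩
        rw [Term.subst, mark, layerFold_of_le le_rfl] at h1
        rw [Term.subst, mark, layerFold_of_not_le hle]
        exact .dia h1
  | @arg n f ts i t h ih =>
    obtain ⟨s, h1, h2⟩ := ih (A.argSort f i)
    have h3 := MSt.arg f (fun j => mark A (A.argSort f j) (ts j)) i h1
    have h4 : (Marked.func f (Function.update (fun j => mark A (A.argSort f j) (ts j)) i s)).erase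
        = .func f (Function.update ts i t) := by
      simp only [Marked.erase]
      rw [update_map (fun _ (u : Marked L V) => u.erase), h2]
      simp only [erase_mark]
    by_cases hf : A.resSort f ≤ α
    · rw [mark, layerFold_of_le hf]
      exact ⟨_, h3, h4⟩
    · rw [mark, layerFold_of_not_le hf]
      exact ⟨_, .dia h3, h4⟩

end Marked

/-! ### Removing marks for left-linear systems. -/

section LeftLinear

variable {L : FirstOrder.Language.{u, v}} {V : Type w} {W S : Type*} [PartialOrder S]
variable {A : SortAttachment L V S} {R : TRS L V}

/-- `Del t u` holds if `u` is obtained from `t` by removing marks. -/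
inductive Del : Marked L V → Marked L V → Prop
  | var (x : V) : Del (.var x) (.var x)
  | func {n : ℕ} (f : L.Functions n) {ts us : Fin n → Marked L V} (h : ∀ i, Del (ts i) (us i)) :
      Del (.func f ts) (.func f us)
  | dia {t u : Marked L V} (h : Del t u) : Del (.dia t) (.dia u)
  | skip {t u : Marked L V} (h : Del t u) : Del (.dia t) u

theorem Del.erase_eq {t u : Marked L V} (h : Del t u) : t.erase = u.erase := by
  induction h with
  | var x => rfl
  | func f h ih => simp [Marked.erase, ih]
  | dia h ih => exact ih
  | skip h ih => exact ih

theorem Del.inv_func {n : ℕ} (f : L.Functions n) (ts : Fin n → Marked L V) (u : Marked L V)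
    (h : Del (.func f ts) u) : ∃ us, u = .func f us ∧ ∀ i, Del (ts i) (us i) := by
  cases h with
  | func f h => exact ⟨_, rfl, h⟩

theorem Del.evalMarked {σ τ : V → Marked L V} {t : L.Term V}
    (h : ∀ x, Mem x t → Del (σ x) (τ x)) : Del (evalMarked σ t) (evalMarked τ t) := by
  induction t with
  | var x => exact h x rfl
  | func f ts ih => exact .func f fun i => ih i fun x hx => h x ⟨i, hx⟩

theorem Del.step (hR : R.LeftLinear) {t t' u : Marked L V} (h : Del t u) (ht : MSt R t t') :
    ∃ u', MSt R u u' ∧ Del t' u' := by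
  induction ht generalizing u with
  | @root l r hlr σ =>
    generalize hs : OrderSorted.evalMarked σ l = s at h
    cases l with
    | var x => exact absurd rfl (R.lhs_not_var _ _ hlr x)
    | func f ts =>
      rw [← hs] at h
      obtain ⟨τ, h1, h2⟩ := (hR _ r hlr).match (F := fun f ts => Marked.func f ts)
        (G := fun f ts => Marked.func f ts) (E := Del) Del.inv_func h
      exact ⟨_, h1 ▸ .root hlr τ, .evalMarked fun x hx => h2 x (R.mem_of_mem hlr hx)⟩
  | arg f ts i h' ih =>
    obtain ⟨us, rfl, hus⟩ := Del.inv_func f ts u h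
    obtain ⟨u', h1, h2⟩ := ih (hus i)
    refine ⟨_, .arg f us i h1, .func f fun j => ?_⟩
    by_cases hji : j = i
    · subst hji; simpa using h2
    · simpa [hji] using hus j
  | dia h' ih =>
    cases h with
    | dia h =>
      obtain ⟨u', h1, h2⟩ := ih h
      exact ⟨_, .dia h1, .dia h2⟩
    | skip h =>
      obtain ⟨u', h1, h2⟩ := ih h
      exact ⟨_, h1, .skip h2⟩

theorem Del.rtg (hR : R.LeftLinear) {t t' u : Marked L V} (h : Del t u)
    (ht : ReflTransGen (MSt R) t t') : ∃ u', ReflTransGen (MSt R) u u' ∧ Del t' u' := by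
  induction ht with
  | refl => exact ⟨u, .refl, h⟩
  | tail _ h' ih =>
    obtain ⟨u', h1, h2⟩ := ih
    obtain ⟨u'', h3, h4⟩ := h2.step hR h'
    exact ⟨u'', h1.tail h3, h4⟩

/-- The canonical marking is the least one: a fitting term has a mark at every genuine violation,
and marks on variables, on marks, or on terms that fit anyway can go. -/
theorem del_mark {t : Marked L V} {α : S} (h : MFit A t α) : Del t (mark A α t.erase) := by
  induction t generalizing α with
  | var x => exact .var x
  | func f ts ih =>
    rw [Marked.erase, mark, layerFold_of_le h.1]
    exact .func f fun i => ih i (h.2 i)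
  | dia t ih =>
    obtain ⟨β, hβ⟩ := h
    cases t with
    | var x => exact .skip (.var x)
    | dia t => exact .skip (ih (α := α) hβ)
    | func f ts =>
      have := ih hβ
      rw [Marked.erase, mark, layerFold_of_le hβ.1] at this
      by_cases hf : A.resSort f ≤ α
      · rw [Marked.erase, Marked.erase, mark, layerFold_of_le hf]
        exact .skip this
      · rw [Marked.erase, Marked.erase, mark, layerFold_of_not_le hf]
        exact .dia this

/-- Rewriting sequences and mark removal together have the diamond property: two removals meet in
the canonical marking, and removal commutes with rewriting by linearity. Erasure carries this to
plain terms. -/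
theorem confAt_of_leftLinear (hcomp : R.Compatible A) (hR : R.LeftLinear)
    (hconf : ∀ (t : Marked L V) (α : S), MFit A t α → ConfAt (MSt R) t) (t : L.Term V) (α : S) :
    ConfAt (St R) t := by
  let Q : Marked L V → Marked L V → Prop := fun t u =>
    MFit A t α ∧ (ReflTransGen (MSt R) t u ∨ (MFit A u α ∧ Del t u))
  have hQ : ∀ {s}, MFit A s α → Q s (mark A α s.erase) := fun hs =>
    ⟨hs, .inr ⟨mark_fit α _, del_mark hs⟩⟩
  have comm : ∀ {s b c}, MFit A s α → ReflTransGen (MSt R) s b → MFit A c α → Del s c →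
      ∃ d, Q b d ∧ Q c d := by
    intro s b c hs hb hc h
    obtain ⟨d, h1, h2⟩ := h.rtg hR hb
    exact ⟨d, ⟨rtg_mfit hcomp hb hs, .inr ⟨rtg_mfit hcomp h1 hc, h2⟩⟩, ⟨hc, .inl h1⟩⟩
  have diamond : ∀ a b c, Q a b → Q a c → ∃ d, Q b d ∧ Q c d := by
    rintro a b c ⟨ha, hb | ⟨hb, hb'⟩⟩ ⟨-, hc | ⟨hc, hc'⟩⟩
    · obtain ⟨d, h1, h2⟩ := hconf a α ha b c hb hc
      exact ⟨d, ⟨rtg_mfit hcomp hb ha, .inl h1⟩, ⟨rtg_mfit hcomp hc ha, .inl h2⟩⟩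
    · exact comm ha hb hc hc'
    · obtain ⟨d, h1, h2⟩ := comm ha hc hb hb'
      exact ⟨d, h2, h1⟩
    · refine ⟨_, hQ hb, ?_⟩
      rw [← hb'.erase_eq, hc'.erase_eq]
      exact hQ hc
  have lift : ∀ {b}, ReflTransGen (St R) t b → ReflTransGen Q (mark A α t) (mark A α b) := by
    intro b hb
    induction hb with
    | refl => exact .refl
    | @tail a b _ h ih =>
      obtain ⟨s, h1, h2⟩ := mark_step hcomp h α
      have hs := h1.fit hcomp (mark_fit α a)
      exact (ih.tail ⟨mark_fit α a, .inl (.single h1)⟩).tail (h2 ▸ hQ hs)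
  have proj : ∀ {a b}, ReflTransGen Q a b → ReflTransGen (St R) a.erase b.erase := by
    intro a b h
    induction h with
    | refl => exact .refl
    | tail _ h ih =>
      rcases h.2 with h | h
      · exact ih.trans (h.lift _ fun _ _ => MSt.erase)
      · rw [← h.2.erase_eq]; exact ih
  intro b c hb hc
  obtain ⟨d, h1, h2⟩ := Relation.church_rosser
    (fun a b c h1 h2 => (diamond a b c h1 h2).imp fun d h => ⟨.single h.1, .single h.2⟩)
    (lift hb) (lift hc)
  exact ⟨d.erase, by simpa only [erase_mark] using proj h1,
    by simpa only [erase_mark] using proj h2⟩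

end LeftLinear

/-! ### Removing marks for bounded duplicating systems. -/

section BoundedDuplicating

variable {L : FirstOrder.Language.{u, v}} {V : Type w} {W S : Type*} [PartialOrder S]
variable {A : SortAttachment L V S} {R : TRS L V}

/-- Marks as diamonds. -/
def Marked.code : Marked L V → (withDiamond L).Term V
  | .var x => .var x
  | .dia t => diamondTerm t.code
  | .func f ts => dfunc f fun i => (ts i).code

theorem MSt.code {s t : Marked L V} (h : MSt R s t) : Step R.liftRules s.code t.code := by
  induction h with
  | root h σ =>
    have key : ∀ t : L.Term V, (evalMarked σ t).code = eval dfunc (fun x => (σ x).code) t :=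
      map_eval Marked.code (fun _ _ => rfl) σ
    rw [key, key]
    exact step_eval h _
  | arg f ts i h ih =>
    simp only [Marked.code]
    rw [update_map (fun _ (u : Marked L V) => u.code)]
    exact step_dfunc f _ i _ ih
  | dia h ih => exact step_diamondTerm ih

theorem eq_mark_or_transGen (x : V) {t : Marked L V} {α : S} (h : MFit A t α) :
    t = mark A α t.erase ∨
      TransGen (Step diamondRules) t.code (mark A α t.erase).code := by
  induction t generalizing α with
  | var x => exact .inl rfl
  | func f ts ih =>
    rw [Marked.erase, mark, layerFold_of_le h.1]
    rcases eq_or_transGen_func f Marked.code ts _ (fun i => ih i (h.2 i)) with h' | h'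
    · exact .inl (congrArg _ h')
    · exact .inr h'
  | dia t ih =>
    have skip : MFit A t α → TransGen (Step diamondRules) (Marked.dia t).code
        (mark A α t.erase).code := by
      intro ht
      rcases ih ht with h' | h'
      · rw [← h']
        exact .single (step_diamond x _)
      · exact h'.head (step_diamond x _)
    obtain ⟨β, hβ⟩ := h
    cases t with
    | var x => exact .inr (skip trivial)
    | dia t => exact .inr (skip hβ)
    | func f ts =>
      by_cases hf : A.resSort f ≤ α
      · exact .inr (skip ⟨hf, hβ.2⟩)
      · have := ih hβ
        rw [Marked.erase, mark, layerFold_of_le hβ.1] at this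
        rw [Marked.erase, Marked.erase, mark, layerFold_of_not_le hf]
        rcases this with h' | h'
        · exact .inl (congrArg _ h')
        · exact .inr (h'.lift _ fun _ _ => step_diamondTerm)

/-- Again `confAt_of_normalize`: normalization discards superfluous marks, which are literally
diamonds. -/
theorem confAt_of_boundedDuplicating (hcomp : R.Compatible A) (hR : R.BoundedDuplicating)
    (hconf : ∀ (t : Marked L V) (α : S), MFit A t α → ConfAt (MSt R) t) (t : L.Term V) (α : S) :
    ConfAt (St R) t := by
  obtain ⟨x, -⟩ := (A.infinite_vars α).nonempty
  have := confAt_of_normalize (MSt R) (St R) Marked.erase (fun s => mark A α s.erase)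
    (fun s => MFit A s α) (fun _ _ hs h => h.fit hcomp hs) (fun _ _ => mark_fit α _)
    (fun _ _ h => h.erase) (fun _ _ => erase_mark α _) (fun _ _ _ h => mark_step hcomp h α)
    (fun s hs => hconf s α hs)
    (fun s t => TransGen (Relative (Step diamondRules) (Step R.liftRules)) s.code t.code)
    (InvImage.wf Marked.code hR)
    (fun s t hs hst hne => transGen_relative (hst.lift _ fun _ _ => MSt.code)
      ((eq_mark_or_transGen x (rtg_mfit hcomp hst hs)).resolve_left fun h => hne h.symm))
    (mark A α t) (mark_fit α t)
  simpa only [erase_mark] using this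

end BoundedDuplicating
end OrderSorted

namespace OrderSorted

open FirstOrder.Language (Term LHom)
open Relation (ReflTransGen TransGen)

/-! ### Strongly compatible systems: ranks, stable aliens and tops. -/

section StronglyCompatible

variable {L : FirstOrder.Language} {V S : Type*} [PartialOrder S]
variable {A : SortAttachment L V S} {R : TRS L V}

variable (A) in
/-- The number of nested violations of the sort constraints in a term used at a position of sort
`α`. -/
noncomputable abbrev rk (α : S) (t : L.Term V) : ℕ :=
  layerFold A (fun _ ms => Finset.univ.sup ms) (fun _ _ => 0) (fun _ _ m => m + 1) α t

variable (A) in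
/-- The number of nested violations of the sort constraints inside a term. -/
noncomputable def ownRk : L.Term V → ℕ
  | .var _ => 0
  | .func f ts => Finset.univ.sup fun i => rk A (A.argSort f i) (ts i)

variable (A) in
/-- A term that violates the sort constraints when it is used at a position of sort `α`. -/
def Alien (α : S) : L.Term V → Prop
  | .var _ => False
  | .func f _ => ¬ A.resSort f ≤ α

theorem rk_of_alien {α : S} {t : L.Term V} (h : Alien A α t) : rk A α t = ownRk A t + 1 := by
  cases t with
  | var x => exact h.elim
  | func f ts => exact layerFold_of_not_le h

theorem rk_of_not_alien {α : S} {t : L.Term V} (h : ¬ Alien A α t) : rk A α t = ownRk A t := by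
  cases t with
  | var x => rfl
  | func f ts => exact layerFold_of_le (not_not.1 h)

theorem ownRk_le_rk (α : S) (t : L.Term V) : ownRk A t ≤ rk A α t := by
  by_cases h : Alien A α t
  · rw [rk_of_alien h]; omega
  · rw [rk_of_not_alien h]

theorem rk_le_ownRk_succ (α : S) (t : L.Term V) : rk A α t ≤ ownRk A t + 1 := by
  by_cases h : Alien A α t
  · rw [rk_of_alien h]
  · rw [rk_of_not_alien h]; omega

theorem rk_arg_le {n : ℕ} (f : L.Functions n) (ts : Fin n → L.Term V) (i : Fin n) :
    rk A (A.argSort f i) (ts i) ≤ ownRk A (.func f ts) :=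
  Finset.le_sup (f := fun i => rk A (A.argSort f i) (ts i)) (Finset.mem_univ i)

/-- The root symbol of a left-hand side has the sort of the left-hand side. -/
theorem alien_lhs_iff {l r : L.Term V} (hlr : (l, r) ∈ R.rules) {γ : S} (hl : HasSort A l γ)
    {σ : V → L.Term V} {α : S} : Alien A α (l.subst σ) ↔ ¬ γ ≤ α := by
  cases hl with
  | var x => exact absurd rfl (R.lhs_not_var _ _ hlr x)
  | func f ts β _ _ => rfl

/-- Both sides of a rule lie in one layer, so the rank of an instance is the maximum over its
variables, and the right-hand side has no new ones. Both ranks are needed at once, since a step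
below an argument changes ranks relative to the argument sort. -/
theorem St.ownRk_rk_le (hR : R.StronglyCompatible A) {t t' : L.Term V} (h : St R t t') :
    ownRk A t' ≤ ownRk A t ∧ ∀ α, rk A α t' ≤ rk A α t := by
  induction h with
  | @root l r hlr σ =>
    obtain ⟨γ, hγ⟩ := hR.1.exists_sort hlr
    have key : ∀ α, γ ≤ α → rk A α (r.subst σ) ≤ rk A α (l.subst σ) := by
      intro α hα
      rw [rk, rk, layerFold_lhs hR.1 hlr hγ hα, layerFold_rhs hR hlr hγ hα, eval_sup_le_iff]
      exact fun x hx => eval_sup_le_iff (σ := fun x => rk A (A.varSort x) (σ x)).1 le_rfl x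
        (R.mem_of_mem hlr hx)
    have hown : ownRk A (r.subst σ) ≤ ownRk A (l.subst σ) := by
      rw [← rk_of_not_alien (α := γ) (t := l.subst σ)
        fun h => (alien_lhs_iff hlr hγ).1 h le_rfl]
      exact (ownRk_le_rk γ _).trans (key γ le_rfl)
    refine ⟨hown, fun α => ?_⟩
    by_cases hα : γ ≤ α
    · exact key α hα
    · rw [rk_of_alien ((alien_lhs_iff hlr hγ).2 hα)]
      exact (rk_le_ownRk_succ α _).trans (Nat.succ_le_succ hown)
  | @arg n f ts i t h ih =>
    have hown : ownRk A (.func f (Function.update ts i t)) ≤ ownRk A (.func f ts) := by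
      refine Finset.sup_le fun j _ => le_trans ?_ (rk_arg_le f ts j)
      by_cases hji : j = i
      · subst hji; simpa using ih.2 _
      · simp [hji]
    refine ⟨hown, fun α => ?_⟩
    by_cases hα : Alien A α (.func f ts)
    · rw [rk_of_alien hα]
      exact (rk_le_ownRk_succ α _).trans (Nat.succ_le_succ hown)
    · rw [rk_of_not_alien hα, rk_of_not_alien (t := .func f (Function.update ts i t)) hα]
      exact hown

theorem rtg_ownRk_le (hR : R.StronglyCompatible A) {t t' : L.Term V}
    (h : ReflTransGen (St R) t t') : ownRk A t' ≤ ownRk A t :=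
  rtg_invariant (I := fun u => ownRk A u ≤ ownRk A t)
    (fun _ _ h1 h2 => (h2.ownRk_rk_le hR).1.trans h1) le_rfl h

theorem rtg_rk_le (hR : R.StronglyCompatible A) {t t' : L.Term V} (α : S)
    (h : ReflTransGen (St R) t t') : rk A α t' ≤ rk A α t :=
  rtg_invariant (I := fun u => rk A α u ≤ rk A α t)
    (fun _ _ h1 h2 => ((h2.ownRk_rk_le hR).2 α).trans h1) le_rfl h

variable (A R) in
/-- A term all of whose reducts violate the sort constraints at a position of sort `α`. -/
def StableAlien (α : S) (t : L.Term V) : Prop :=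
  ∀ t', ReflTransGen (St R) t t' → Alien A α t'

variable (A R) in
/-- All maximal violations of the sort constraints persist under rewriting. -/
def Preserved (α : S) (t : L.Term V) : Prop :=
  layerFold A (fun _ ps => ∀ i, ps i) (fun _ _ => True) (fun α t _ => StableAlien A R α t) α t

theorem preserved_func_of_le {α : S} {n : ℕ} {f : L.Functions n} {ts : Fin n → L.Term V}
    (h : A.resSort f ≤ α) :
    Preserved A R α (.func f ts) ↔ ∀ i, Preserved A R (A.argSort f i) (ts i) := by
  rw [Preserved, layerFold_of_le h]; rfl

theorem preserved_of_alien {α : S} {t : L.Term V} (h : Alien A α t) :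
    Preserved A R α t ↔ StableAlien A R α t := by
  cases t with
  | var x => exact h.elim
  | func f ts => rw [Preserved, layerFold_of_not_le h]

theorem StableAlien.preserved {α : S} {t : L.Term V} (h : StableAlien A R α t) :
    Preserved A R α t :=
  (preserved_of_alien (h t .refl)).2 h

theorem StableAlien.rtg {α : S} {t t' : L.Term V} (h : StableAlien A R α t)
    (ht : ReflTransGen (St R) t t') : StableAlien A R α t' :=
  fun u hu => h u (ht.trans hu)

theorem Preserved.step (hR : R.StronglyCompatible A) {t t' : L.Term V} (h : St R t t') {α : S}
    (ht : Preserved A R α t) : Preserved A R α t' := by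
  induction h generalizing α with
  | @root l r hlr σ =>
    by_cases ha : Alien A α (l.subst σ)
    · exact (((preserved_of_alien ha).1 ht).rtg (.single (.root hlr σ))).preserved
    · obtain ⟨γ, hγ⟩ := hR.1.exists_sort hlr
      have hα : γ ≤ α := by simpa [alien_lhs_iff hlr hγ] using ha
      rw [Preserved, layerFold_lhs hR.1 hlr hγ hα, eval_forall_iff] at ht
      rw [Preserved, layerFold_rhs hR hlr hγ hα, eval_forall_iff]
      exact fun x hx => ht x (R.mem_of_mem hlr hx)
  | arg f ts i h ih =>
    by_cases ha : A.resSort f ≤ α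
    · rw [preserved_func_of_le ha] at ht ⊢
      intro j
      by_cases hji : j = i
      · subst hji; simpa using ih (ht j)
      · simpa [hji] using ht j
    · exact (((preserved_of_alien (t := .func f ts) ha).1 ht).rtg
        (.single (.arg f ts i h))).preserved

/-- An unstable alien is reduced until it fits; this saves the violation at its root, so the rank
drops and induction applies. -/
theorem exists_preserved (hR : R.StronglyCompatible A) (t : L.Term V) (α : S) :
    ∃ p, ReflTransGen (St R) t p ∧ Preserved A R α p := by
  suffices H : ∀ k t α, rk A α t ≤ k → ∃ p, ReflTransGen (St R) t p ∧ Preserved A R α p from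
    H _ t α le_rfl
  clear t α
  intro k
  induction k using Nat.strong_induction_on with
  | _ k ihk =>
  intro t
  induction t with
  | var x => exact fun α _ => ⟨_, .refl, trivial⟩
  | func f ts ih =>
    intro α hk
    by_cases hα : A.resSort f ≤ α
    · rw [rk_of_not_alien (t := .func f ts) (not_not.2 hα)] at hk
      choose ps h1 h2 using fun i => ih i _ ((rk_arg_le f ts i).trans hk)
      exact ⟨_, rtg_func f h1, (preserved_func_of_le hα).2 h2⟩
    · by_cases hs : StableAlien A R α (.func f ts)
      · exact ⟨_, .refl, hs.preserved⟩
      · simp only [StableAlien, not_forall] at hs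
        obtain ⟨u, hu, hu'⟩ := hs
        rw [rk_of_alien (t := .func f ts) hα] at hk
        obtain ⟨p, h1, h2⟩ := ihk (rk A α u)
          (by rw [rk_of_not_alien hu']; have := rtg_ownRk_le hR hu; omega) u α le_rfl
        exact ⟨p, hu.trans h1, h2⟩

/-- The top of a term, where maximal violations of the sort constraints are abstracted to
variables. -/
noncomputable abbrev topTerm (A : SortAttachment L V S) (r : L.Term V → L.Term V → Prop) (α : S)
    (t : L.Term V) : L.Term (V ⊕ Quot r) :=
  layerFold A (fun f ts => .func f ts) (fun _ x => .var (.inl x))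
    (fun _ t _ => .var (.inr (Quot.mk r t))) α t

open Classical in
/-- A representative of a class that is preserved if possible. -/
noncomputable def preservedRep (A : SortAttachment L V S) (R : TRS L V)
    (r : L.Term V → L.Term V → Prop) (α : S) (c : Quot r) : L.Term V :=
  if h : ∃ p, Quot.mk r p = c ∧ Preserved A R α p then h.choose else c.out

/-- The top of a term, where maximal violations of the sort constraints are replaced by the tops of
preserved representatives of their classes. -/
noncomputable abbrev barTerm (A : SortAttachment L V S) (R : TRS L V)
    (r : L.Term V → L.Term V → Prop) (α : S) (t : L.Term V) : L.Term (V ⊕ Quot r) :=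
  layerFold A (fun f ts => .func f ts) (fun _ x => .var (.inl x))
    (fun α t _ => topTerm A r α (preservedRep A R r α (Quot.mk r t))) α t

/-- The maximal violations of the sort constraints. -/
noncomputable abbrev aliens (A : SortAttachment L V S) (α : S) (t : L.Term V) : Set (L.Term V) :=
  layerFold A (fun _ Ts => ⋃ i, Ts i) (fun _ _ => ∅) (fun _ t _ => {t}) α t

theorem finite_aliens (α : S) (t : L.Term V) : (aliens A α t).Finite := by
  induction t generalizing α with
  | var x => exact Set.finite_empty
  | func f ts ih =>
    by_cases h : A.resSort f ≤ α
    · rw [aliens, layerFold_of_le h]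
      exact Set.finite_iUnion fun i => ih i _
    · rw [aliens, layerFold_of_not_le h]
      exact Set.finite_singleton _

theorem topTerm_of_alien {r : L.Term V → L.Term V → Prop} {α : S} {t : L.Term V}
    (h : Alien A α t) : topTerm A r α t = .var (.inr (Quot.mk r t)) := by
  cases t with
  | var x => exact h.elim
  | func f ts => exact layerFold_of_not_le h

theorem barTerm_of_alien {r : L.Term V → L.Term V → Prop} {α : S} {t : L.Term V}
    (h : Alien A α t) :
    barTerm A R r α t = topTerm A r α (preservedRep A R r α (Quot.mk r t)) := by
  cases t with
  | var x => exact h.elim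
  | func f ts => exact layerFold_of_not_le h

theorem topTerm_fit (r : L.Term V → L.Term V → Prop) (α : S) (t : L.Term V) :
    Fit A (fun _ _ => True) (topTerm A r α t) α := by
  induction t generalizing α with
  | var x => trivial
  | func f ts ih =>
    by_cases h : A.resSort f ≤ α
    · rw [topTerm, layerFold_of_le h]
      exact ⟨h, fun i => ih i _⟩
    · rw [topTerm, layerFold_of_not_le h]
      trivial

theorem barTerm_fit (r : L.Term V → L.Term V → Prop) (α : S) (t : L.Term V) :
    Fit A (fun _ _ => True) (barTerm A R r α t) α := by
  induction t generalizing α with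
  | var x => trivial
  | func f ts ih =>
    by_cases h : A.resSort f ≤ α
    · rw [barTerm, layerFold_of_le h]
      exact ⟨h, fun i => ih i _⟩
    · rw [barTerm, layerFold_of_not_le h]
      exact topTerm_fit r α _

theorem rtg_subst_topTerm {r : L.Term V → L.Term V → Prop} {φ : Quot r → L.Term V} {α : S}
    {t : L.Term V} (h : ∀ u ∈ aliens A α t, ReflTransGen (St R) u (φ (Quot.mk r u))) :
    ReflTransGen (St R) t ((topTerm A r α t).subst (Sum.elim .var φ)) := by
  induction t generalizing α with
  | var x => exact .refl
  | func f ts ih =>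
    by_cases hf : A.resSort f ≤ α
    · rw [aliens, layerFold_of_le hf] at h
      rw [topTerm, layerFold_of_le hf]
      exact rtg_func f fun i => ih i fun u hu => h u (Set.mem_iUnion.2 ⟨i, hu⟩)
    · rw [aliens, layerFold_of_not_le hf] at h
      rw [topTerm, layerFold_of_not_le hf]
      exact h _ rfl

/-! ### One level of the induction: `r` is rewriting of terms of own rank below `n`. -/

section Level

variable {n : ℕ} {r : L.Term V → L.Term V → Prop}

theorem topTerm_step (hR : R.StronglyCompatible A)
    (hr : ∀ a b, r a b ↔ ownRk A a < n ∧ St R a b) {t t' : L.Term V} (h : St R t t') {α : S}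
    (hk : rk A α t ≤ n) (ht : Preserved A R α t) :
    ReflTransGen (St R) (topTerm A r α t) (topTerm A r α t') := by
  have alien : ∀ {t t' : L.Term V} {α}, St R t t' → rk A α t ≤ n → Preserved A R α t →
      Alien A α t → ReflTransGen (St R) (topTerm A r α t) (topTerm A r α t') := by
    intro t t' α h hk ht ha
    have ha' := (preserved_of_alien ha).1 ht t' (.single h)
    rw [rk_of_alien ha] at hk
    rw [topTerm_of_alien ha, topTerm_of_alien ha', Quot.sound ((hr t t').2 ⟨hk, h⟩)]
  induction h generalizing α with
  | @root l r' hlr σ =>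
    by_cases ha : Alien A α (l.subst σ)
    · exact alien (.root hlr σ) hk ht ha
    · obtain ⟨γ, hγ⟩ := hR.1.exists_sort hlr
      have hα : γ ≤ α := by simpa [alien_lhs_iff hlr hγ] using ha
      rw [topTerm, topTerm, layerFold_lhs hR.1 hlr hγ hα, layerFold_rhs hR hlr hγ hα,
        ← subst_eq_eval, ← subst_eq_eval]
      exact .single (.root hlr _)
  | arg f ts i h ih =>
    by_cases ha : A.resSort f ≤ α
    · rw [topTerm, topTerm, layerFold_of_le ha, layerFold_of_le ha]
      rw [preserved_func_of_le ha] at ht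
      rw [rk_of_not_alien (t := .func f ts) (not_not.2 ha)] at hk
      refine rtg_func f fun j => ?_
      by_cases hji : j = i
      · subst hji
        rw [Function.update_self]
        exact ih ((rk_arg_le f ts j).trans hk) (ht j)
      · rw [Function.update_of_ne hji]
    · exact alien (.arg f ts i h) hk ht ha

theorem topTerm_rtg (hR : R.StronglyCompatible A)
    (hr : ∀ a b, r a b ↔ ownRk A a < n ∧ St R a b) {t t' : L.Term V}
    (h : ReflTransGen (St R) t t') {α : S} (hk : rk A α t ≤ n) (ht : Preserved A R α t) :
    Preserved A R α t' ∧ ReflTransGen (St R) (topTerm A r α t) (topTerm A r α t') := by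
  induction h with
  | refl => exact ⟨ht, .refl⟩
  | tail h' h ih => exact ⟨ih.1.step hR h,
      ih.2.trans (topTerm_step hR hr h ((rtg_rk_le hR α h').trans hk) ih.1)⟩

theorem exists_preserved_joinable (hR : R.StronglyCompatible A)
    (hr : ∀ a b, r a b ↔ ownRk A a < n ∧ St R a b) (hrc : Confluent r) {u : L.Term V} {α : S}
    (hu : ownRk A u < n) : ∃ z, ReflTransGen r u z ∧ Preserved A R α z ∧
      ReflTransGen (St R) (topTerm A r α (preservedRep A R r α (Quot.mk r u)))
        (topTerm A r α z) := by
  have hr' : ∀ {a b}, ReflTransGen r a b → ReflTransGen (St R) a b := fun h =>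
    h.lift id fun a b h => ((hr a b).1 h).2
  have hex : ∃ p, Quot.mk r p = Quot.mk r u ∧ Preserved A R α p := by
    obtain ⟨p, h1, h2⟩ := exists_preserved hR u α
    refine ⟨p, (quot_eq_of_rtg ?_).symm, h2⟩
    refine (rtg_restrict (I := fun a => ownRk A a < n) (fun a b ha h => ?_) hu h1).lift id
      fun a b h => (hr a b).2 h
    exact (h.ownRk_rk_le hR).1.trans_lt ha
  rw [preservedRep, dif_pos hex]
  set p := hex.choose
  obtain ⟨z, h1, h2⟩ := joinable_of_quot_eq hrc hex.choose_spec.1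
  -- The chosen `p` is only known to be convertible to `u`: either it makes an `r`-step, or it
  -- equals `z`, a reduct of `u`.
  have hp : ownRk A p < n := by
    rcases h1.cases_head with h | ⟨w, hw, _⟩
    · rw [show p = z from h]
      exact (rtg_ownRk_le hR (hr' h2)).trans_lt hu
    · exact ((hr _ _).1 hw).1
  obtain ⟨h3, h4⟩ := topTerm_rtg hR hr (hr' h1) ((rk_le_ownRk_succ α p).trans hp)
    hex.choose_spec.2
  exact ⟨z, h2, h3, h4⟩

/-- Aliens of a preserved term are stable, so the representative's top reduces to the top of a term
that is still alien, that is, to the variable naming the class. -/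
theorem rtg_barTerm_topTerm (hR : R.StronglyCompatible A)
    (hr : ∀ a b, r a b ↔ ownRk A a < n ∧ St R a b) (hrc : Confluent r) {t : L.Term V} {α : S}
    (hk : rk A α t ≤ n) (ht : Preserved A R α t) :
    ReflTransGen (St R) (barTerm A R r α t) (topTerm A r α t) := by
  induction t generalizing α with
  | var x => exact .refl
  | func f ts ih =>
    by_cases hf : A.resSort f ≤ α
    · rw [barTerm, topTerm, layerFold_of_le hf, layerFold_of_le hf]
      rw [preserved_func_of_le hf] at ht
      rw [rk_of_not_alien (t := .func f ts) (not_not.2 hf)] at hk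
      exact rtg_func f fun i => ih i ((rk_arg_le f ts i).trans hk) (ht i)
    · have ha : Alien A α (.func f ts) := hf
      rw [rk_of_alien ha] at hk
      obtain ⟨z, h1, -, h2⟩ := exists_preserved_joinable hR hr hrc (α := α) hk
      have hz : Alien A α z := (preserved_of_alien ha).1 ht z
        (h1.lift id fun a b h => ((hr a b).1 h).2)
      rw [topTerm_of_alien hz, ← quot_eq_of_rtg h1] at h2
      rwa [barTerm_of_alien ha, topTerm_of_alien ha]

/-- `barTerm` treats an alien through its class alone, so only a fusing step is critical. If the
alien `t` becomes a fitting `t'`, then `t'` reduces to a preserved `z` whose top is also reached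
from the representative's top. Induction on rank links `t'` to `z`. -/
theorem joinable_barTerm (hR : R.StronglyCompatible A)
    (hr : ∀ a b, r a b ↔ ownRk A a < n ∧ St R a b) (hrc : Confluent r)
    (hconf : ∀ (s : L.Term (V ⊕ Quot r)) (α : S), Fit A (fun _ _ => True) s α →
      ConfAt (St R) s) {t t' : L.Term V} {α : S}
    (hk : rk A α t ≤ n) (h : St R t t') :
    Joinable (St R) (barTerm A R r α t) (barTerm A R r α t') := by
  suffices H : ∀ k t t' α, rk A α t ≤ k → rk A α t ≤ n → St R t t' →
      Joinable (St R) (barTerm A R r α t) (barTerm A R r α t') from H _ t t' α le_rfl hk h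
  clear hk h t t' α
  intro k
  induction k using Nat.strong_induction_on with
  | _ k ihk =>
  have alien : ∀ {t t' : L.Term V} {α}, rk A α t ≤ k → rk A α t ≤ n → St R t t' →
      Alien A α t → Joinable (St R) (barTerm A R r α t) (barTerm A R r α t') := by
    intro t t' α hk hn h ha
    rw [rk_of_alien ha] at hk hn
    have hq : Quot.mk r t = Quot.mk r t' := Quot.sound ((hr t t').2 ⟨hn, h⟩)
    rw [barTerm_of_alien ha, hq]
    by_cases ha' : Alien A α t'
    · rw [barTerm_of_alien ha']
      exact .refl _
    · have ho := (h.ownRk_rk_le hR).1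
      obtain ⟨z, h1, h2, h3⟩ := exists_preserved_joinable hR hr hrc (α := α)
        (ho.trans_lt hn)
      have hrk := rk_of_not_alien ha'
      have h1' : ReflTransGen (St R) t' z := h1.lift id fun a b h => ((hr a b).1 h).2
      -- Having fused, `t'` has rank below `k` at `α`, and so have its reducts.
      have key : Joinable (St R) (barTerm A R r α t') (barTerm A R r α z) := by
        clear h2 h3 h1
        induction h1' with
        | refl => exact .refl _
        | @tail b c hb hbc ih =>
          have := rtg_rk_le hR α hb
          exact ih.trans (hconf _ α (barTerm_fit r α _))
            (ihk (rk A α b) (by omega) b c α le_rfl (by omega) hbc)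
      have hz := rtg_barTerm_topTerm hR hr hrc ((rtg_rk_le hR α h1').trans (by omega)) h2
      exact (Joinable.of_rtg h3).trans (hconf _ α (topTerm_fit r α z))
        ((Joinable.of_rtg hz).symm.trans (hconf _ α (barTerm_fit r α z)) key.symm)
  intro t t' α hk hn h
  induction h generalizing α with
  | @root l r' hlr σ =>
    by_cases ha : Alien A α (l.subst σ)
    · exact alien hk hn (.root hlr σ) ha
    · obtain ⟨γ, hγ⟩ := hR.1.exists_sort hlr
      have hα : γ ≤ α := by simpa [alien_lhs_iff hlr hγ] using ha
      rw [barTerm, barTerm, layerFold_lhs hR.1 hlr hγ hα, layerFold_rhs hR hlr hγ hα,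
        ← subst_eq_eval, ← subst_eq_eval]
      exact .of_rtg (.single (.root hlr _))
  | arg f ts i h ih =>
    by_cases ha : A.resSort f ≤ α
    · rw [barTerm, barTerm, layerFold_of_le ha, layerFold_of_le ha]
      rw [rk_of_not_alien (t := .func f ts) (not_not.2 ha)] at hk hn
      refine joinable_func f fun j => ?_
      by_cases hji : j = i
      · subst hji
        rw [Function.update_self]
        exact ih _ ((rk_arg_le f ts j).trans hk) ((rk_arg_le f ts j).trans hn)
      · rw [Function.update_of_ne hji]
        exact .refl _
    · exact alien hk hn (.arg f ts i h) ha

/-- Returns from auxiliary terms to actual reducts: each alien is rewritten to a common reduct with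
its representative. -/
theorem exists_rtg_barTerm_topTerm (hR : R.StronglyCompatible A)
    (hr : ∀ a b, r a b ↔ ownRk A a < n ∧ St R a b) (hrc : Confluent r) {t : L.Term V} {α : S}
    (hk : rk A α t ≤ n) : ∃ t₁, ReflTransGen (St R) t t₁ ∧
      ReflTransGen (St R) (barTerm A R r α t) (topTerm A r α t₁) := by
  induction t generalizing α with
  | var x => exact ⟨_, .refl, .refl⟩
  | func f ts ih =>
    by_cases hf : A.resSort f ≤ α
    · rw [rk_of_not_alien (t := .func f ts) (not_not.2 hf)] at hk
      choose us h1 h2 using fun i => ih i ((rk_arg_le f ts i).trans hk)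
      refine ⟨_, rtg_func f h1, ?_⟩
      rw [barTerm, topTerm, layerFold_of_le hf, layerFold_of_le hf]
      exact rtg_func f h2
    · have ha : Alien A α (.func f ts) := hf
      rw [rk_of_alien ha] at hk
      obtain ⟨z, h1, -, h2⟩ := exists_preserved_joinable hR hr hrc (α := α) hk
      rw [barTerm_of_alien ha]
      exact ⟨z, h1.lift id fun a b h => ((hr a b).1 h).2, h2⟩

end Level

theorem confAt_of_stronglyCompatible (hR : R.StronglyCompatible A)
    (hconf : ∀ (r : L.Term V → L.Term V → Prop) (s : L.Term (V ⊕ Quot r)) (α : S),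
      Fit A (fun _ _ => True) s α → ConfAt (St R) s) (t : L.Term V) : ConfAt (St R) t := by
  suffices H : ∀ n (t : L.Term V), ownRk A t < n → ConfAt (St R) t from
    H _ t (Nat.lt_succ_self _)
  clear t
  intro n
  induction n with
  | zero => intro t h; omega
  | succ n ih =>
  intro t hn
  let r : L.Term V → L.Term V → Prop := fun a b => ownRk A a < n ∧ St R a b
  have hr : ∀ a b, r a b ↔ ownRk A a < n ∧ St R a b := fun _ _ => Iff.rfl
  have hrc : Confluent r := confluent_restrict
    (fun a b ha h => (h.ownRk_rk_le hR).1.trans_lt ha) ih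
  -- A sort at which `t` itself is no violation, so that its rank is its own rank and thus at most
  -- `n`.
  obtain ⟨α, hα⟩ : ∃ α, ¬ Alien A α t := by
    cases t with
    | var x => exact ⟨A.varSort x, id⟩
    | func f ts => exact ⟨A.resSort f, not_not.2 le_rfl⟩
  have hk : rk A α t ≤ n := by rw [rk_of_not_alien hα]; omega
  have hbar : ∀ b, ReflTransGen (St R) t b →
      Joinable (St R) (barTerm A R r α t) (barTerm A R r α b) := by
    intro b hb
    induction hb with
    | refl => exact .refl _
    | tail hb h ih =>
      exact ih.trans (hconf r _ α (barTerm_fit r α _))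
        (joinable_barTerm hR hr hrc (hconf r) ((rtg_rk_le hR α hb).trans hk) h)
  have htop : ∀ b, ReflTransGen (St R) t b → ∃ b₁, ReflTransGen (St R) b b₁ ∧
      Joinable (St R) (barTerm A R r α t) (topTerm A r α b₁) := by
    intro b hb
    obtain ⟨b₁, h1, h2⟩ := exists_rtg_barTerm_topTerm hR hr hrc
      ((rtg_rk_le hR α hb).trans hk)
    exact ⟨b₁, h1, (hbar b hb).trans (hconf r _ α (barTerm_fit r α _)) (.of_rtg h2)⟩
  intro b c hb hc
  obtain ⟨b₁, hbb, hb₁⟩ := htop b hb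
  obtain ⟨c₁, hcc, hc₁⟩ := htop c hc
  obtain ⟨e, hbe, hce⟩ := hb₁.symm.trans (hconf r _ α (barTerm_fit r α _)) hc₁
  obtain ⟨φ, hφ, hφb⟩ := exists_balanced hrc (finite_aliens (A := A) α b₁)
  obtain ⟨ψ, hψ, hψc⟩ := exists_balanced hrc (finite_aliens (A := A) α c₁)
  choose χ hχ₁ hχ₂ using fun c => joinable_of_quot_eq hrc ((hφ c).trans (hψ c).symm)
  have side : ∀ {b : L.Term V} {φ : Quot r → L.Term V},
      (∀ u ∈ aliens A α b, ReflTransGen r u (φ (Quot.mk r u))) →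
      ReflTransGen (St R) (topTerm A r α b) e → (∀ c, ReflTransGen r (φ c) (χ c)) →
      ReflTransGen (St R) b (e.subst (Sum.elim .var χ)) := by
    intro b φ h1 h2 h3
    refine ((rtg_subst_topTerm fun u hu => rtg_of_restrict (h1 u hu)).trans
      (rtg_subst h2 _)).trans (rtg_subst_of_forall ?_)
    rintro (x | c) _
    · exact .refl
    · exact rtg_of_restrict (h3 c)
  exact ⟨_, hbb.trans (side hφb hbe hχ₁), hcc.trans (side hψc hce hχ₂)⟩

end StronglyCompatible
end OrderSorted

theorem mainTheorem4 {L : FirstOrder.Language} {V : Type*} {S : Type*} [PartialOrder S]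
    (A : OrderSorted.SortAttachment L V S) (R : OrderSorted.TRS L V)
    (hcompat : R.Compatible A)
    (hR : R.LeftLinear ∨ R.BoundedDuplicating ∨ R.StronglyCompatible A)
    (hconf : OrderSorted.ConfluentOn (OrderSorted.Step R.rules) (OrderSorted.sortedTerms A)) :
    OrderSorted.Confluent (OrderSorted.Step R.rules) := by
  have hst : OrderSorted.Step R.rules = OrderSorted.St R :=
    funext fun _ => funext fun _ => propext OrderSorted.st_iff_step.symm
  rw [hst]
  intro a
  have hmarked : ∀ (t : OrderSorted.Marked L V) (α : S), OrderSorted.MFit A t α →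
      OrderSorted.ConfAt (OrderSorted.MSt R) t := fun t α ht =>
    OrderSorted.mconfAt_of_mfit hcompat
      (fun _ _ _ h => OrderSorted.confAt_of_fit hconf hcompat hR h) ht
  have hS : Nonempty S := by
    cases a with
    | var x => exact ⟨A.varSort x⟩
    | func f ts => exact ⟨A.resSort f⟩
  rcases hR with h | h | h
  · exact OrderSorted.confAt_of_leftLinear hcompat h hmarked a hS.some
  · exact OrderSorted.confAt_of_boundedDuplicating hcompat h hmarked a hS.some
  · exact OrderSorted.confAt_of_stronglyCompatible h
      (fun _ _ _ ht => OrderSorted.confAt_of_fit_of_stronglyCompatible hconf h ht) a
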